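/- Let $W=\langle s,t\mid s^2=t^2=1\rangle$ be the infinite dihedral group with word length $|\cdot|$, and let $q_s,q_t>0$ be real numbers. For $w\in W$ let $q^w=q_{s_1}\cdots q_{s_k}$, where $w=s_1\cdots s_k$ is any reduced expression in the generators $s,t$. Let $\mathbb R_{\mathbf q}W$ be the Hecke algebra with $\mathbb R$-basis $(T_w)_{w\in W}$ and multiplication determined, for $u\in\{s,t\}$, by \[ T_wT_u=\begin{cases}T_{wu}&\text{if }|wu|>|w|,\\(q_u-1)T_w+q_uT_{wu}&\text{if }|wu|<|w|,\end{cases} \qquad T_uT_w=\begin{cases}T_{uw}&\text{if }|uw|>|w|,\\(q_u-1)T_w+q_uT_{uw}&\text{if }|uw|<|w|,\end{cases} \] and let $L^2_{\mathbf q}W$ be its (real) Hilbert space completion for the inner product $\langle T_w,T_{w'}\rangle=q^w\delta_{w,w'}$. Identify the group algebra $\mathbb RW$ with $\mathbb R_{\mathbf q}W$ through the algebra isomorphism sending $u$ to $\frac{1-q_u}{1+q_u}+\frac{2}{1+q_u}T_u$ for $u\in\{s,t\}$; in this way $\mathbb RW$ acts on $L^2_{\mathbf q}W$ by bounded right multiplications.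 For an $m\times n$ matrix $M$ with entries in $\mathbb RW$, let $R_M:(L^2_{\mathbf q}W)^m\to(L^2_{\mathbf q}W)^n$ be right multiplication by $M$, $(xM)_j=\sum_i x_iM_{ij}$. For a closed left $\mathbb RW$-invariant subspace $V\subseteq(L^2_{\mathbf q}W)^m$ let \[ \dim_W^{\mathbf q}V=\sum_{i=1}^m\langle \operatorname{pr}_V(\epsilon_i),\epsilon_i\rangle , \] where $\operatorname{pr}_V$ is the orthogonal projection onto $V$ and $\epsilon_i$ is the vector with $1=T_1$ in position $i$ and $0$ elsewhere. Let $\Lambda_{\mathbf q}$ be the additive subgroup of $\mathbb R$ generated by $1$, $\frac1{1+q_s}$ and $\frac1{1+q_t}$. Then for all $m,n$ and every $m\times n$ matrix $M$ with entries in $\mathbb RW$, \[ \dim_W^{\mathbf q}\ker R_M\in\Lambda_{\mathbf q}. \] Moreover, $\Lambda_{\mathbf q}$ is the smallest subgroup of $\mathbb R$ with this property: every additive subgroup $\Gamma\subseteq\mathbb R$ that contains $\dim_W^{\mathbf q}\ker R_M$ for all $m,n$ and all such $M$ contains $\Lambda_{\mathbf q}$. -/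

import Mathlib

open scoped InnerProductSpace

noncomputable section

namespace HeckeDihedral

/-! ### The infinite dihedral group and its word length -/

/-- The infinite dihedral group `⟨s, t | s² = t² = 1⟩`. -/
abbrev W : Type := DihedralGroup 0

/-- Labels of the two standard generators. -/
inductive Gen : Type
  | s : Gen
  | t : Gen

/-- The standard generators `s` and `t` of `W`; their product `s * t` is the translation `r 1`. -/
def gen : Gen → W
  | Gen.s => DihedralGroup.sr 0
  | Gen.t => DihedralGroup.sr 1

/-- The word length of `w`: the least length of an expression of `w` as a product of generators. -/
def wordLength (w : W) : ℕ :=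
  sInf {n : ℕ | ∃ l : List Gen, l.length = n ∧ (l.map gen).prod = w}

/-- The integer underlying an element of `ZMod 0` (which is `ℤ` by definition). -/
def toInt (i : ZMod 0) : ℤ := i

/-- An explicit formula for the word length (see `wordLength_eq`). -/
def len : W → ℕ
  | DihedralGroup.r i => 2 * Int.natAbs (toInt i)
  | DihedralGroup.sr i => Int.natAbs (2 * toInt i - 1)

theorem gen_mul_self (i : Gen) : gen i * gen i = 1 := by
  cases i <;> rfl

theorem mul_gen_mul_gen (w : W) (i : Gen) : w * gen i * gen i = w := by
  rw [mul_assoc, gen_mul_self, mul_one]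

theorem gen_s_mul_gen_t : gen Gen.s * gen Gen.t = DihedralGroup.r 1 := rfl

/-- Right multiplication by a generator changes the length by exactly one. -/
theorem len_mul_gen (w : W) (i : Gen) :
    len (w * gen i) = len w + 1 ∨ len w = len (w * gen i) + 1 := by
  cases w with
  | r j =>
    cases i
    · change Int.natAbs (2 * ((0 : ℤ) - toInt j) - 1) = 2 * Int.natAbs (toInt j) + 1 ∨
        2 * Int.natAbs (toInt j) = Int.natAbs (2 * ((0 : ℤ) - toInt j) - 1) + 1
      generalize toInt j = k
      omega
    · change Int.natAbs (2 * ((1 : ℤ) - toInt j) - 1) = 2 * Int.natAbs (toInt j) + 1 ∨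
        2 * Int.natAbs (toInt j) = Int.natAbs (2 * ((1 : ℤ) - toInt j) - 1) + 1
      generalize toInt j = k
      omega
  | sr j =>
    cases i
    · change 2 * Int.natAbs ((0 : ℤ) - toInt j) = Int.natAbs (2 * toInt j - 1) + 1 ∨
        Int.natAbs (2 * toInt j - 1) = 2 * Int.natAbs ((0 : ℤ) - toInt j) + 1
      generalize toInt j = k
      omega
    · change 2 * Int.natAbs ((1 : ℤ) - toInt j) = Int.natAbs (2 * toInt j - 1) + 1 ∨
        Int.natAbs (2 * toInt j - 1) = 2 * Int.natAbs ((1 : ℤ) - toInt j) + 1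
      generalize toInt j = k
      omega

/-- Every element of positive length can be shortened by a generator on the right. -/
theorem exists_len_mul_gen (w : W) (hw : len w ≠ 0) : ∃ i, len w = len (w * gen i) + 1 := by
  cases w with
  | r j =>
    by_cases hj : (0 : ℤ) < toInt j
    · refine ⟨Gen.t, ?_⟩
      change 2 * Int.natAbs (toInt j) = Int.natAbs (2 * ((1 : ℤ) - toInt j) - 1) + 1
      generalize toInt j = k at hj
      omega
    · refine ⟨Gen.s, ?_⟩
      change 2 * Int.natAbs (toInt j) ≠ 0 at hw
      change 2 * Int.natAbs (toInt j) = Int.natAbs (2 * ((0 : ℤ) - toInt j) - 1) + 1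
      generalize toInt j = k at hj hw
      omega
  | sr j =>
    by_cases hj : (0 : ℤ) < toInt j
    · refine ⟨Gen.t, ?_⟩
      change Int.natAbs (2 * toInt j - 1) = 2 * Int.natAbs ((1 : ℤ) - toInt j) + 1
      generalize toInt j = k at hj
      omega
    · refine ⟨Gen.s, ?_⟩
      change Int.natAbs (2 * toInt j - 1) = 2 * Int.natAbs ((0 : ℤ) - toInt j) + 1
      generalize toInt j = k at hj
      omega

theorem eq_one_of_len_eq_zero (w : W) (hw : len w = 0) : w = 1 := by
  cases w with
  | r j =>
    change 2 * Int.natAbs (toInt j) = 0 at hw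
    have h0 : toInt j = 0 := by
      generalize toInt j = k at hw
      omega
    exact congrArg DihedralGroup.r h0
  | sr j =>
    exfalso
    change Int.natAbs (2 * toInt j - 1) = 0 at hw
    generalize toInt j = k at hw
    omega

theorem len_prod_le (l : List Gen) : len (l.map gen).prod ≤ l.length := by
  induction l using List.reverseRecOn with
  | nil => exact Nat.le_refl 0
  | append_singleton l i ih =>
    have h := len_mul_gen (l.map gen).prod i
    simp only [List.map_append, List.map_cons, List.map_nil, List.prod_append,
      List.prod_singleton, List.length_append, List.length_singleton]
    omega

theorem exists_word (n : ℕ) :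
    ∀ w : W, len w = n → ∃ l : List Gen, l.length = n ∧ (l.map gen).prod = w := by
  induction n with
  | zero => exact fun w hw => ⟨[], rfl, (eq_one_of_len_eq_zero w hw).symm⟩
  | succ n ih =>
    intro w hw
    obtain ⟨i, hi⟩ := exists_len_mul_gen w (by omega)
    obtain ⟨l, hl, hp⟩ := ih (w * gen i) (by omega)
    exact ⟨l ++ [i], by simp [hl], by simp [hp, mul_gen_mul_gen]⟩

theorem wordLength_eq (w : W) : wordLength w = len w := by
  apply le_antisymm
  · exact Nat.sInf_le (exists_word _ w rfl)
  · have hne : {n : ℕ | ∃ l : List Gen, l.length = n ∧ (l.map gen).prod = w}.Nonempty :=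
      ⟨_, exists_word _ w rfl⟩
    obtain ⟨l, h1, h2⟩ := Nat.sInf_mem hne
    have h3 := len_prod_le l
    rw [h1, h2] at h3
    exact h3

theorem wordLength_mul_gen (w : W) (i : Gen) :
    wordLength (w * gen i) = wordLength w + 1 ∨ wordLength w = wordLength (w * gen i) + 1 := by
  simpa only [wordLength_eq] using len_mul_gen w i

/-! ### The weights `q^w` -/

/-- `q^w`: the product of the `q_i` over a reduced expression of `w`
(see `prod_eq_qpow` for the fact that every reduced expression gives this value). -/
def qpow (q : Gen → ℝ) : W → ℝ
  | DihedralGroup.r i => (q Gen.s * q Gen.t) ^ Int.natAbs (toInt i)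
  | DihedralGroup.sr i =>
      if toInt i ≤ 0 then q Gen.s ^ (Int.natAbs (toInt i) + 1) * q Gen.t ^ Int.natAbs (toInt i)
      else q Gen.s ^ (Int.natAbs (toInt i) - 1) * q Gen.t ^ Int.natAbs (toInt i)

theorem qpow_mul_gen (q : Gen → ℝ) (w : W) (i : Gen) (h : wordLength w < wordLength (w * gen i)) :
    qpow q (w * gen i) = qpow q w * q i := by
  simp only [wordLength_eq] at h
  cases w with
  | r j =>
    cases i
    · change 2 * Int.natAbs (toInt j) < Int.natAbs (2 * ((0 : ℤ) - toInt j) - 1) at h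
      change (if ((0 : ℤ) - toInt j) ≤ 0
        then q Gen.s ^ (Int.natAbs ((0 : ℤ) - toInt j) + 1) * q Gen.t ^ Int.natAbs ((0 : ℤ) - toInt j)
        else q Gen.s ^ (Int.natAbs ((0 : ℤ) - toInt j) - 1) * q Gen.t ^ Int.natAbs ((0 : ℤ) - toInt j)) =
        (q Gen.s * q Gen.t) ^ Int.natAbs (toInt j) * q Gen.s
      generalize toInt j = k at h ⊢
      rw [if_pos (by omega), show ((0 : ℤ) - k).natAbs = k.natAbs by omega]
      ring
    · change 2 * Int.natAbs (toInt j) < Int.natAbs (2 * ((1 : ℤ) - toInt j) - 1) at h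
      change (if ((1 : ℤ) - toInt j) ≤ 0
        then q Gen.s ^ (Int.natAbs ((1 : ℤ) - toInt j) + 1) * q Gen.t ^ Int.natAbs ((1 : ℤ) - toInt j)
        else q Gen.s ^ (Int.natAbs ((1 : ℤ) - toInt j) - 1) * q Gen.t ^ Int.natAbs ((1 : ℤ) - toInt j)) =
        (q Gen.s * q Gen.t) ^ Int.natAbs (toInt j) * q Gen.t
      generalize toInt j = k at h ⊢
      rw [if_neg (by omega), show ((1 : ℤ) - k).natAbs = k.natAbs + 1 by omega,
        Nat.add_sub_cancel]
      ring
  | sr j =>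
    cases i
    · change Int.natAbs (2 * toInt j - 1) < 2 * Int.natAbs ((0 : ℤ) - toInt j) at h
      change (q Gen.s * q Gen.t) ^ Int.natAbs ((0 : ℤ) - toInt j) = (if toInt j ≤ 0
        then q Gen.s ^ (Int.natAbs (toInt j) + 1) * q Gen.t ^ Int.natAbs (toInt j)
        else q Gen.s ^ (Int.natAbs (toInt j) - 1) * q Gen.t ^ Int.natAbs (toInt j)) * q Gen.s
      generalize toInt j = k at h ⊢
      obtain ⟨n, hn⟩ : ∃ n, k.natAbs = n + 1 := ⟨k.natAbs - 1, by omega⟩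
      rw [if_neg (by omega), show ((0 : ℤ) - k).natAbs = k.natAbs by omega, hn,
        Nat.add_sub_cancel]
      ring
    · change Int.natAbs (2 * toInt j - 1) < 2 * Int.natAbs ((1 : ℤ) - toInt j) at h
      change (q Gen.s * q Gen.t) ^ Int.natAbs ((1 : ℤ) - toInt j) = (if toInt j ≤ 0
        then q Gen.s ^ (Int.natAbs (toInt j) + 1) * q Gen.t ^ Int.natAbs (toInt j)
        else q Gen.s ^ (Int.natAbs (toInt j) - 1) * q Gen.t ^ Int.natAbs (toInt j)) * q Gen.t
      generalize toInt j = k at h ⊢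
      rw [if_pos (by omega), show ((1 : ℤ) - k).natAbs = k.natAbs + 1 by omega]
      ring

theorem qpow_one (q : Gen → ℝ) : qpow q 1 = 1 := by
  change (q Gen.s * q Gen.t) ^ Int.natAbs 0 = 1
  simp

/-- An initial segment of a reduced word is reduced, and the last letter increases the length. -/
theorem reduced_of_append (l : List Gen) (i : Gen)
    (h : wordLength ((l ++ [i]).map gen).prod = (l ++ [i]).length) :
    wordLength (l.map gen).prod = l.length ∧
      wordLength (l.map gen).prod < wordLength ((l.map gen).prod * gen i) := by
  have h1 := len_prod_le l
  have h2 := wordLength_mul_gen (l.map gen).prod i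
  rw [← wordLength_eq] at h1
  simp only [List.map_append, List.map_cons, List.map_nil, List.prod_append,
      List.prod_singleton, List.length_append, List.length_singleton] at h
  omega

theorem prod_eq_qpow (q : Gen → ℝ) (l : List Gen)
    (h : wordLength (l.map gen).prod = l.length) :
    (l.map q).prod = qpow q (l.map gen).prod := by
  induction l using List.reverseRecOn with
  | nil => exact (qpow_one q).symm
  | append_singleton l i ih =>
    obtain ⟨h1, h2⟩ := reduced_of_append l i h
    simp only [List.map_append, List.map_cons, List.map_nil, List.prod_append,
      List.prod_singleton]
    rw [qpow_mul_gen q _ i h2, ih h1]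

theorem qpow_pos (q : Gen → ℝ) (hq : ∀ i, 0 < q i) (w : W) : 0 < qpow q w := by
  have hs := hq Gen.s
  have ht := hq Gen.t
  cases w with
  | r j => exact pow_pos (mul_pos hs ht) _
  | sr j =>
    unfold qpow
    simp only
    split_ifs <;> positivity

/-! ### The Hilbert space `L²_q W` and the right Hecke action -/

/-- The Hilbert space `L²_q W`, in coordinates with respect to its orthonormal basis
`(q^w)^(-1/2) T_w`, `w ∈ W`; that is, `x : L2` stands for `∑ w, x w • (q^w)^(-1/2) T_w`. -/
abbrev L2 : Type := lp (fun _ : W => ℝ) 2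

open Classical in
/-- The Hecke basis vector `T_w`, of square norm `q^w`. -/
def T (q : Gen → ℝ) (w : W) : L2 := lp.single 2 w (Real.sqrt (qpow q w))

/-- Translation `x ↦ (w ↦ x (w * gen i))` on `ℓ²(W)`. -/
def transl (i : Gen) : L2 →L[ℝ] L2 :=
  LinearMap.mkContinuous
    { toFun := fun x => ⟨fun w => x (w * gen i), by
        have h := (lp.memℓp x).summable (by norm_num)
        exact memℓp_gen ((Equiv.mulRight (gen i)).summable_iff.mpr h)⟩
      map_add' := fun _ _ => rfl
      map_smul' := fun _ _ => rfl } 1 (by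
    intro x
    rw [one_mul, lp.norm_eq_tsum_rpow (by norm_num), lp.norm_eq_tsum_rpow (by norm_num)]
    exact le_of_eq (congrArg (fun z : ℝ => z ^ (1 / (2 : ENNReal).toReal))
      ((Equiv.mulRight (gen i)).tsum_eq (fun w => ‖x w‖ ^ (2 : ENNReal).toReal))))

theorem transl_apply (i : Gen) (x : L2) (w : W) : transl i x w = x (w * gen i) := rfl

open Classical in
/-- Restriction of `x ∈ ℓ²(W)` to the `w` with `|w * gen i| < |w|`. -/
def descent (i : Gen) : L2 →L[ℝ] L2 :=
  LinearMap.mkContinuous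
    { toFun := fun x => ⟨fun w => if wordLength (w * gen i) < wordLength w then x w else 0, by
        refine (lp.memℓp x).mono' (fun w => ?_)
        split_ifs <;> simp⟩
      map_add' := fun x y => by
        ext w
        change (if _ then x w + y w else 0) = (if _ then x w else 0) + (if _ then y w else 0)
        split_ifs <;> simp
      map_smul' := fun c x => by
        ext w
        change (if _ then c * x w else 0) = c * (if _ then x w else 0)
        split_ifs <;> simp } 1 (by
    intro x
    rw [one_mul]
    refine lp.norm_mono (by norm_num) (fun w => ?_)
    change ‖if _ then x w else 0‖ ≤ ‖x w‖
    split_ifs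
    · exact le_refl _
    · rw [norm_zero]
      exact norm_nonneg _)

open Classical in
theorem descent_apply (i : Gen) (x : L2) (w : W) :
    descent i x w = if wordLength (w * gen i) < wordLength w then x w else 0 := rfl

/-- Right multiplication by the Hecke generator `T_i` on `L²_q W` (see `rightT_T` for its values
on the Hecke basis). -/
def rightT (q : Gen → ℝ) (i : Gen) : L2 →L[ℝ] L2 :=
  Real.sqrt (q i) • transl i + (q i - 1) • descent i

open Classical in
theorem rightT_apply (q : Gen → ℝ) (i : Gen) (x : L2) (w : W) :
    rightT q i x w = Real.sqrt (q i) * x (w * gen i) +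
      (q i - 1) * (if wordLength (w * gen i) < wordLength w then x w else 0) := rfl

/-- The defining right multiplication rule of the Hecke algebra. -/
theorem rightT_T (q : Gen → ℝ) (hq : ∀ i, 0 < q i) (i : Gen) (w : W) :
    rightT q i (T q w) =
      if wordLength w < wordLength (w * gen i) then T q (w * gen i)
      else (q i - 1) • T q w + q i • T q (w * gen i) := by
  classical
  have hlen := wordLength_mul_gen w i
  have key : ∀ v : W, v * gen i = w ↔ v = w * gen i := fun v =>
    ⟨fun h => by rw [← h, mul_gen_mul_gen], fun h => by rw [h, mul_gen_mul_gen]⟩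
  have hq0 := (hq i).le
  split_ifs with h
  · ext v
    have e := qpow_mul_gen q w i h
    rw [rightT_apply]
    simp only [T, lp.single_apply, Pi.single_apply, key]
    by_cases h1 : v = w * gen i
    · subst h1
      have h2 : w * gen i ≠ w := fun h2 => by rw [h2] at h; omega
      simp only [h2, e, Real.sqrt_mul (qpow_pos q hq w).le, if_true, if_false, ite_self]
      ring
    · by_cases h2 : v = w
      · subst h2
        simp [h1, not_lt.mpr h.le]
      · simp [h1, h2]
  · have h' : wordLength (w * gen i) < wordLength w := by omega
    have e := qpow_mul_gen q (w * gen i) i (by rwa [mul_gen_mul_gen])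
    rw [mul_gen_mul_gen] at e
    ext v
    rw [rightT_apply]
    change _ = (q i - 1) * T q w v + q i * T q (w * gen i) v
    simp only [T, lp.single_apply, Pi.single_apply, key]
    by_cases h1 : v = w * gen i
    · subst h1
      have h2 : w * gen i ≠ w := fun h2 => by rw [h2] at h'; omega
      have h3 : Real.sqrt (q i) * Real.sqrt (q i) = q i := Real.mul_self_sqrt hq0
      simp only [h2, e, Real.sqrt_mul (qpow_pos q hq (w * gen i)).le, if_true, if_false, ite_self]
      linear_combination (Real.sqrt (qpow q (w * gen i))) * h3
    · by_cases h2 : v = w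
      · subst h2
        simp [h1, h']
      · simp [h1, h2]

/-- The quadratic Hecke relation. -/
theorem rightT_rightT (q : Gen → ℝ) (hq : ∀ i, 0 < q i) (i : Gen) (x : L2) :
    rightT q i (rightT q i x) = (q i - 1) • rightT q i x + q i • x := by
  classical
  ext w
  have h3 : Real.sqrt (q i) * Real.sqrt (q i) = q i := Real.mul_self_sqrt (hq i).le
  change _ = (q i - 1) * rightT q i x w + q i * x w
  simp only [rightT_apply, mul_gen_mul_gen]
  rcases wordLength_mul_gen w i with h | h
  · simp only [if_neg (show ¬ wordLength (w * gen i) < wordLength w by omega),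
      if_pos (show wordLength w < wordLength (w * gen i) by omega)]
    linear_combination x w * h3
  · simp only [if_pos (show wordLength (w * gen i) < wordLength w by omega),
      if_neg (show ¬ wordLength w < wordLength (w * gen i) by omega)]
    linear_combination x w * h3

/-! ### The right action of the group algebra `ℝW` -/

/-- Right multiplication by the group element `gen i`, which is identified with the element
`(1 - q_i) / (1 + q_i) + 2 / (1 + q_i) T_i` of the Hecke algebra. -/
def rightGen (q : Gen → ℝ) (i : Gen) : L2 →L[ℝ] L2 :=
  ((1 - q i) / (1 + q i)) • ContinuousLinearMap.id ℝ L2 + (2 / (1 + q i)) • rightT q i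

theorem rightGen_mul_self (q : Gen → ℝ) (hq : ∀ i, 0 < q i) (i : Gen) :
    rightGen q i * rightGen q i = 1 := by
  ext1 x
  have h : 1 + q i ≠ 0 := by have := hq i; positivity
  change ((1 - q i) / (1 + q i)) • (((1 - q i) / (1 + q i)) • x + (2 / (1 + q i)) • rightT q i x) +
    (2 / (1 + q i)) •
      rightT q i (((1 - q i) / (1 + q i)) • x + (2 / (1 + q i)) • rightT q i x) = x
  rw [map_add, map_smul, map_smul, rightT_rightT q hq i x]
  match_scalars <;> field_simp <;> ring

/-- The homomorphism from `W` to a monoid determined by two elements of square one. -/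
def liftW {A : Type*} [Monoid A] (a b : A) (ha : a * a = 1) (hb : b * b = 1) : W →* A :=
  let u : Aˣ := ⟨a * b, b * a, by rw [mul_assoc, ← mul_assoc b, hb, one_mul, ha],
    by rw [mul_assoc, ← mul_assoc a, ha, one_mul, hb]⟩
  let v : Aˣ := ⟨a, a, ha, ha⟩
  have hv : v * v = 1 := Units.ext ha
  have huv : ∀ n : ℤ, u ^ n * v = v * u ^ (-n) := fun n => by
    have h1 : v * u⁻¹ * v⁻¹ = u := Units.ext (by
      change a * (b * a) * a = a * b
      rw [← mul_assoc, mul_assoc, ha, mul_one])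
    have h2 : u ^ n = v * u ^ (-n) * v⁻¹ := by
      rw [zpow_neg, ← inv_zpow, ← conj_zpow, h1]
    rw [h2, inv_mul_cancel_right]
  { toFun := fun w => match w with
      | DihedralGroup.r i => ((u ^ toInt i : Aˣ) : A)
      | DihedralGroup.sr i => ((v * u ^ toInt i : Aˣ) : A)
    map_one' := by
      change ((u ^ (0 : ℤ) : Aˣ) : A) = 1
      simp
    map_mul' := by
      rintro (i | i) (j | j)
      · change ((u ^ (toInt i + toInt j) : Aˣ) : A) = ((u ^ toInt i : Aˣ) : A) * (u ^ toInt j : Aˣ)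
        rw [zpow_add, Units.val_mul]
      · change ((v * u ^ (toInt j - toInt i) : Aˣ) : A) =
          ((u ^ toInt i : Aˣ) : A) * (v * u ^ toInt j : Aˣ)
        rw [← Units.val_mul, ← mul_assoc (u ^ toInt i), huv, mul_assoc, ← zpow_add,
          sub_eq_neg_add]
      · change ((v * u ^ (toInt i + toInt j) : Aˣ) : A) =
          ((v * u ^ toInt i : Aˣ) : A) * (u ^ toInt j : Aˣ)
        rw [zpow_add, ← Units.val_mul, mul_assoc]
      · change ((u ^ (toInt j - toInt i) : Aˣ) : A) =
          ((v * u ^ toInt i : Aˣ) : A) * (v * u ^ toInt j : Aˣ)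
        rw [← Units.val_mul, mul_assoc, ← mul_assoc (u ^ toInt i), huv, mul_assoc, ← mul_assoc v,
          hv, one_mul, ← zpow_add, sub_eq_neg_add] }

theorem liftW_gen_s {A : Type*} [Monoid A] (a b : A) (ha : a * a = 1) (hb : b * b = 1) :
    liftW a b ha hb (gen Gen.s) = a := by
  let u : Aˣ := ⟨a * b, b * a, by rw [mul_assoc, ← mul_assoc b, hb, one_mul, ha],
    by rw [mul_assoc, ← mul_assoc a, ha, one_mul, hb]⟩
  let v : Aˣ := ⟨a, a, ha, ha⟩
  change ((v * u ^ (0 : ℤ) : Aˣ) : A) = a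
  rw [zpow_zero, mul_one]

theorem liftW_gen_t {A : Type*} [Monoid A] (a b : A) (ha : a * a = 1) (hb : b * b = 1) :
    liftW a b ha hb (gen Gen.t) = b := by
  let u : Aˣ := ⟨a * b, b * a, by rw [mul_assoc, ← mul_assoc b, hb, one_mul, ha],
    by rw [mul_assoc, ← mul_assoc a, ha, one_mul, hb]⟩
  let v : Aˣ := ⟨a, a, ha, ha⟩
  change ((v * u ^ (1 : ℤ) : Aˣ) : A) = b
  rw [zpow_one]
  change a * (a * b) = b
  rw [← mul_assoc, ha, one_mul]

/-- The right action of the group algebra `ℝW` on `L²_q W` by bounded operators, as an algebra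
homomorphism to the opposite algebra of bounded operators: the unique one sending each generator
`gen i` to `rightGen q i`. -/
def rightAction (q : Gen → ℝ) (hq : ∀ i, 0 < q i) :
    MonoidAlgebra ℝ W →ₐ[ℝ] (L2 →L[ℝ] L2)ᵐᵒᵖ :=
  MonoidAlgebra.lift ℝ (L2 →L[ℝ] L2)ᵐᵒᵖ W
    (liftW (MulOpposite.op (rightGen q Gen.s)) (MulOpposite.op (rightGen q Gen.t))
      (congrArg MulOpposite.op (rightGen_mul_self q hq Gen.s))
      (congrArg MulOpposite.op (rightGen_mul_self q hq Gen.t)))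

/-- Right multiplication by `y ∈ ℝW` on `L²_q W`. -/
def rightMul (q : Gen → ℝ) (hq : ∀ i, 0 < q i) (y : MonoidAlgebra ℝ W) : L2 →L[ℝ] L2 :=
  MulOpposite.unop (rightAction q hq y)

theorem rightMul_gen (q : Gen → ℝ) (hq : ∀ i, 0 < q i) (i : Gen) :
    rightMul q hq (MonoidAlgebra.of ℝ W (gen i)) = rightGen q i := by
  unfold rightMul rightAction
  rw [MonoidAlgebra.lift_of]
  cases i
  · rw [liftW_gen_s, MulOpposite.unop_op]
  · rw [liftW_gen_t, MulOpposite.unop_op]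

theorem rightMul_mul (q : Gen → ℝ) (hq : ∀ i, 0 < q i) (x y : MonoidAlgebra ℝ W) (v : L2) :
    rightMul q hq (x * y) v = rightMul q hq y (rightMul q hq x v) := by
  unfold rightMul
  rw [map_mul, MulOpposite.unop_mul]
  rfl

/-! ### `L²_q W` as the completion of `ℝW` -/

/-- The element `τ_i` of `ℝW` corresponding to the Hecke generator `T_i`, that is
`gen i = (1 - q_i) / (1 + q_i) + 2 / (1 + q_i) τ_i`. -/
def tauGen (q : Gen → ℝ) (i : Gen) : MonoidAlgebra ℝ W :=
  ((q i - 1) / 2) • 1 + ((q i + 1) / 2) • MonoidAlgebra.of ℝ W (gen i)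

/-- The embedding of `ℝW` in `L²_q W`, sending `1` to `T_1`. It has dense range, turns right
multiplication in `ℝW` into `rightMul`, and sends `τ_w` to `T_w`; so `L²_q W` is the completion
of `ℝW` for the inner product with `⟨τ_w, τ_w'⟩ = q^w δ_{w,w'}`. -/
def toL2 (q : Gen → ℝ) (hq : ∀ i, 0 < q i) (x : MonoidAlgebra ℝ W) : L2 :=
  rightMul q hq x (T q 1)

theorem rightMul_toL2 (q : Gen → ℝ) (hq : ∀ i, 0 < q i) (x y : MonoidAlgebra ℝ W) :
    rightMul q hq y (toL2 q hq x) = toL2 q hq (x * y) :=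
  (rightMul_mul q hq x y _).symm

theorem rightMul_tauGen (q : Gen → ℝ) (hq : ∀ i, 0 < q i) (i : Gen) :
    rightMul q hq (tauGen q i) = rightT q i := by
  have h : 1 + q i ≠ 0 := by have := hq i; positivity
  have e := rightMul_gen q hq i
  unfold rightMul at e
  unfold rightMul tauGen
  rw [map_add, map_smul, map_smul, map_one, MulOpposite.unop_add, MulOpposite.unop_smul,
    MulOpposite.unop_smul, e, MulOpposite.unop_one]
  ext1 x
  change ((q i - 1) / 2) • x + ((q i + 1) / 2) •
    (((1 - q i) / (1 + q i)) • x + (2 / (1 + q i)) • rightT q i x) = rightT q i x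
  match_scalars <;> field_simp <;> ring

/-- For a reduced expression of `w`, the product `τ_w` of the `τ_i` corresponds to `T_w`. -/
theorem toL2_tau (q : Gen → ℝ) (hq : ∀ i, 0 < q i) (l : List Gen)
    (h : wordLength (l.map gen).prod = l.length) :
    toL2 q hq (l.map (tauGen q)).prod = T q (l.map gen).prod := by
  induction l using List.reverseRecOn with
  | nil =>
    change MulOpposite.unop (rightAction q hq 1) (T q 1) = T q 1
    rw [map_one]
    rfl
  | append_singleton l i ih =>
    obtain ⟨h1, h2⟩ := reduced_of_append l i h
    simp only [List.map_append, List.map_cons, List.map_nil, List.prod_append,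
      List.prod_singleton]
    rw [← rightMul_toL2, ih h1, rightMul_tauGen, rightT_T q hq, if_pos h2]

open Classical in
theorem inner_T_T (q : Gen → ℝ) (hq : ∀ i, 0 < q i) (w w' : W) :
    ⟪T q w, T q w'⟫_ℝ = if w = w' then qpow q w else 0 := by
  have h : ⟪T q w, T q w'⟫_ℝ = ⟪Real.sqrt (qpow q w), T q w' w⟫_ℝ := lp.inner_single_left _ _ _
  rw [h, T, lp.single_apply, Pi.single_apply]
  split_ifs with e
  · subst e
    exact Real.mul_self_sqrt (qpow_pos q hq w).le
  · simp

theorem denseRange_toL2 (q : Gen → ℝ) (hq : ∀ i, 0 < q i) : DenseRange (toL2 q hq) := by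
  classical
  let f : MonoidAlgebra ℝ W →ₗ[ℝ] L2 :=
    { toFun := toL2 q hq
      map_add' := fun x y => by
        unfold toL2 rightMul
        rw [map_add]
        rfl
      map_smul' := fun c x => by
        unfold toL2 rightMul
        rw [map_smul]
        rfl }
  have hT : ∀ w, T q w ∈ LinearMap.range f := fun w => by
    obtain ⟨l, hl, rfl⟩ := exists_word _ w rfl
    exact ⟨_, toL2_tau q hq l (by rw [wordLength_eq, hl])⟩
  have hs : ∀ (w : W) (c : ℝ), (lp.single 2 w c : L2) ∈ LinearMap.range f := fun w c => by
    have h0 : Real.sqrt (qpow q w) ≠ 0 := (Real.sqrt_pos.mpr (qpow_pos q hq w)).ne'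
    have : (lp.single 2 w c : L2) = (c / Real.sqrt (qpow q w)) • T q w := by
      rw [T, ← lp.single_smul, smul_eq_mul, div_mul_cancel₀ _ h0]
    rw [this]
    exact Submodule.smul_mem _ _ (hT w)
  intro x
  have hx := lp.hasSum_single (p := 2) (by norm_num) x
  exact mem_closure_of_tendsto hx (Filter.Eventually.of_forall fun s =>
    Submodule.sum_mem (LinearMap.range f) fun w _ => hs w _)

/-! ### Matrices over `ℝW` and von Neumann dimension -/

/-- The Hilbert space direct sum `(L²_q W)^m`. -/
abbrev L2Pow (m : ℕ) : Type := PiLp 2 (fun _ : Fin m => L2)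

/-- Right multiplication `R_M : (L²_q W)^m → (L²_q W)^n`, `x ↦ x M`, by an `m × n` matrix over
`ℝW`, with rows as vectors: `(x M)_j = ∑ i, x_i M_{i j}`. -/
def rightMulMatrix (q : Gen → ℝ) (hq : ∀ i, 0 < q i) {m n : ℕ}
    (M : Matrix (Fin m) (Fin n) (MonoidAlgebra ℝ W)) : L2Pow m →L[ℝ] L2Pow n :=
  (PiLp.continuousLinearEquiv 2 ℝ (fun _ : Fin n => L2)).symm.toContinuousLinearMap.comp
    (ContinuousLinearMap.pi fun j =>
      ∑ i, (rightMul q hq (M i j)).comp (PiLp.proj 2 (fun _ : Fin m => L2) i))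

theorem rightMulMatrix_apply (q : Gen → ℝ) (hq : ∀ i, 0 < q i) {m n : ℕ}
    (M : Matrix (Fin m) (Fin n) (MonoidAlgebra ℝ W)) (x : L2Pow m) (j : Fin n) :
    rightMulMatrix q hq M x j = ∑ i, rightMul q hq (M i j) (x i) := by
  change (∑ i, (rightMul q hq (M i j)).comp (PiLp.proj 2 (fun _ : Fin m => L2) i)) x = _
  rw [sum_apply]
  rfl

/-- The standard basis element `ε_i` of `(L²_q W)^m`, with the unit `T_1` of the Hecke algebra in
position `i` and `0` elsewhere. -/
def stdBasis (q : Gen → ℝ) {m : ℕ} (i : Fin m) : L2Pow m :=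
  WithLp.toLp 2 (Pi.single i (T q 1))

/-- The Hecke–von Neumann dimension `∑ i, ⟨pr_V ε_i, ε_i⟩` of a closed subspace `V` of
`(L²_q W)^m` (applied below to kernels of the operators `R_M`). -/
def heckeDim (q : Gen → ℝ) {m : ℕ} (V : Submodule ℝ (L2Pow m)) [V.HasOrthogonalProjection] : ℝ :=
  ∑ i, ⟪V.starProjection (stdBasis q i), stdBasis q i⟫_ℝ

/-- The kernel of `R_M`, a closed subspace of `(L²_q W)^m`. -/
abbrev kerRightMul (q : Gen → ℝ) (hq : ∀ i, 0 < q i) {m n : ℕ}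
    (M : Matrix (Fin m) (Fin n) (MonoidAlgebra ℝ W)) : Submodule ℝ (L2Pow m) :=
  LinearMap.ker (rightMulMatrix q hq M).toLinearMap

instance kerRightMul_hasOrthogonalProjection (q : Gen → ℝ) (hq : ∀ i, 0 < q i) {m n : ℕ}
    (M : Matrix (Fin m) (Fin n) (MonoidAlgebra ℝ W)) :
    (kerRightMul q hq M).HasOrthogonalProjection :=
  haveI : CompleteSpace (kerRightMul q hq M) :=
    (ContinuousLinearMap.isClosed_ker (rightMulMatrix q hq M)).completeSpace_coe
  Submodule.HasOrthogonalProjection.ofCompleteSpace _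

/-- The additive subgroup `Λ_q` of `ℝ` generated by `1`, `1/(1+q_s)` and `1/(1+q_t)`. -/
def Lambda (q : Gen → ℝ) : AddSubgroup ℝ :=
  AddSubgroup.closure {1, 1 / (1 + q Gen.s), 1 / (1 + q Gen.t)}

end HeckeDihedral

end

/-!
# Von Neumann dimensions of kernels over the Hecke algebra of the infinite dihedral group

Write `z = st + ts`, a central element of `ℝW`, and let `rank M = m - dim ker R_M` for an `m × n`
matrix `M` over `ℝW`.

*The rank function.* Left and right multiplications by the Hecke generators commute, so
`τ(y) = ⟨y, 1⟩` is a trace on `ℝW` (`tau_mul_comm`). By the mean ergodic theorem `dim ker R_M` is a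
limit of averages of the traces of the powers of `1 - c M M*`, and since `τ` is a trace these differ
from those for `M* M` by `m - n` only. Hence `rank M* = rank M` (`rank_adj`), and a product has
rank at most that of either factor.

*Torsion.* The only eigenvalues of `z` on `L²_q W` are `2` and `-2`: in the orthonormal coordinates
an eigenvector satisfies a recurrence along the Cayley graph, which is a line
(`eigenvalue_zed`). As `2 - z = (s - t)²` and `2 + z = (s + t)²`, the two eigenspaces are spanned by
joint eigenvectors of `s` and `t`. Such an eigenvector is explicit, is square-summable when a
Poincaré series of `W` converges, and spans a subspace of dimension
`1 / (1 + a) + 1 / (1 + b) - 1` with `a ∈ {q_s, 1 / q_s}` and `b ∈ {q_t, 1 / q_t}`, which lies in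
`Λ_q` (`thin_zed_sub`). So multiplying `M` by `z² - 4` changes `dim ker R_M` by an element of `Λ_q`
only (`heckeDim_disc_smul`).

*Away from the torsion.* The function `genericRank M = rank ((z² - 4) M)` does not change when `M`
is multiplied by a nonzero element of `ℝ[z]`. With `e = (1 + s) / 2` one has `e ℝW e = ℝ[z] e`, and
`e` becomes a full idempotent after inverting `z² - 4`; so every matrix reduces to one over the
domain `ℝ[z]`, there to an identity matrix by rank factorization, and `genericRank M` is a natural
multiple of `genericRank e` (`exists_genericRank`). The latter is in `Λ_q` since
`dim ker e = 1 - 1 / (1 + q_s)`.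

Conversely `1`, `1 / (1 + q_s)` and `1 / (1 + q_t)` are the dimensions of the kernels of the
`1 × 0` matrix and of the `1 × 1` matrices `(1 - s) / 2` and `(1 - t) / 2`.
-/

open scoped InnerProductSpace

noncomputable section

namespace HeckeDihedral

/-! ### Right multiplication, adjoints and the trace -/

section RightMul

variable (q : Gen → ℝ) (hq : ∀ i, 0 < q i)

/-- `rightMul` as a linear map in the element of `ℝW`. -/
def rightMulLin : MonoidAlgebra ℝ W →ₗ[ℝ] (L2 →L[ℝ] L2) where
  toFun := rightMul q hq
  map_add' x y := by unfold rightMul; rw [map_add]; rfl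
  map_smul' c x := by unfold rightMul; rw [map_smul]; rfl

theorem rightMul_add (x y : MonoidAlgebra ℝ W) :
    rightMul q hq (x + y) = rightMul q hq x + rightMul q hq y :=
  map_add (rightMulLin q hq) x y

theorem rightMul_sub (x y : MonoidAlgebra ℝ W) :
    rightMul q hq (x - y) = rightMul q hq x - rightMul q hq y :=
  map_sub (rightMulLin q hq) x y

theorem rightMul_smul (c : ℝ) (x : MonoidAlgebra ℝ W) :
    rightMul q hq (c • x) = c • rightMul q hq x :=
  map_smul (rightMulLin q hq) c x

theorem rightMul_sum {ι : Type*} (s : Finset ι) (f : ι → MonoidAlgebra ℝ W) :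
    rightMul q hq (∑ i ∈ s, f i) = ∑ i ∈ s, rightMul q hq (f i) :=
  map_sum (rightMulLin q hq) f s

theorem rightMul_zero : rightMul q hq 0 = 0 :=
  map_zero (rightMulLin q hq)

theorem rightMul_one : rightMul q hq 1 = ContinuousLinearMap.id ℝ L2 := by
  unfold rightMul
  rw [map_one]
  rfl

/-- The involution `w ↦ w⁻¹` of `W`, extended linearly to `ℝW`. -/
def invol (y : MonoidAlgebra ℝ W) : MonoidAlgebra ℝ W :=
  MonoidAlgebra.mapDomain (fun w : W => w⁻¹) y

theorem invol_add (x y : MonoidAlgebra ℝ W) : invol (x + y) = invol x + invol y :=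
  MonoidAlgebra.mapDomain_add _ x y

theorem invol_single (w : W) (c : ℝ) :
    invol (MonoidAlgebra.single w c) = MonoidAlgebra.single w⁻¹ c :=
  MonoidAlgebra.mapDomain_single

theorem invol_smul (c : ℝ) (x : MonoidAlgebra ℝ W) : invol (c • x) = c • invol x :=
  MonoidAlgebra.mapDomain_smul _ c x

theorem invol_sum {ι : Type*} (s : Finset ι) (f : ι → MonoidAlgebra ℝ W) :
    invol (∑ i ∈ s, f i) = ∑ i ∈ s, invol (f i) := by
  classical
  induction s using Finset.induction_on with
  | empty => exact MonoidAlgebra.mapDomain_zero _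
  | insert a s ha ih => rw [Finset.sum_insert ha, Finset.sum_insert ha, invol_add, ih]

theorem invol_invol (y : MonoidAlgebra ℝ W) : invol (invol y) = y := by
  refine MonoidAlgebra.induction_on (motive := fun y => invol (invol y) = y) y
    (fun w => ?_) (fun a b ha hb => ?_) (fun c a ha => ?_)
  · rw [MonoidAlgebra.of_apply, invol_single, invol_single, inv_inv]
  · rw [invol_add, invol_add, ha, hb]
  · rw [invol_smul, invol_smul, ha]

theorem invol_mul (x y : MonoidAlgebra ℝ W) : invol (x * y) = invol y * invol x := by
  refine MonoidAlgebra.induction_on (motive := fun x => invol (x * y) = invol y * invol x) x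
    (fun w => ?_) (fun a b ha hb => ?_) (fun c a ha => ?_)
  · refine MonoidAlgebra.induction_on
      (motive := fun y => invol (MonoidAlgebra.of ℝ W w * y) = invol y * invol _) y
      (fun v => ?_) (fun a b ha hb => ?_) (fun c a ha => ?_)
    · simp only [MonoidAlgebra.of_apply, MonoidAlgebra.single_mul_single, invol_single,
        mul_inv_rev]
    · rw [mul_add, invol_add, invol_add, ha, hb, add_mul]
    · rw [mul_smul_comm, invol_smul, invol_smul, ha, smul_mul_assoc]
  · rw [add_mul, invol_add, invol_add, ha, hb, mul_add]
  · rw [smul_mul_assoc, invol_smul, invol_smul, ha, mul_smul_comm]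

theorem inner_transl (i : Gen) (x y : L2) : ⟪transl i x, y⟫_ℝ = ⟪x, transl i y⟫_ℝ := by
  rw [lp.inner_eq_tsum, lp.inner_eq_tsum, ← (Equiv.mulRight (gen i)).tsum_eq]
  refine tsum_congr fun w => ?_
  change ⟪x (w * gen i * gen i), y (w * gen i)⟫_ℝ = ⟪x w, y (w * gen i)⟫_ℝ
  rw [mul_gen_mul_gen]

theorem inner_descent (i : Gen) (x y : L2) : ⟪descent i x, y⟫_ℝ = ⟪x, descent i y⟫_ℝ := by
  classical
  rw [lp.inner_eq_tsum, lp.inner_eq_tsum]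
  refine tsum_congr fun w => ?_
  rw [descent_apply, descent_apply]
  split_ifs <;> simp

theorem inner_rightT (i : Gen) (x y : L2) : ⟪rightT q i x, y⟫_ℝ = ⟪x, rightT q i y⟫_ℝ := by
  change ⟪Real.sqrt (q i) • transl i x + (q i - 1) • descent i x, y⟫_ℝ =
    ⟪x, Real.sqrt (q i) • transl i y + (q i - 1) • descent i y⟫_ℝ
  simp only [inner_add_left, inner_add_right, real_inner_smul_left, real_inner_smul_right,
    inner_transl, inner_descent]

theorem inner_rightGen (i : Gen) (x y : L2) :
    ⟪rightGen q i x, y⟫_ℝ = ⟪x, rightGen q i y⟫_ℝ := by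
  change ⟪((1 - q i) / (1 + q i)) • x + (2 / (1 + q i)) • rightT q i x, y⟫_ℝ =
    ⟪x, ((1 - q i) / (1 + q i)) • y + (2 / (1 + q i)) • rightT q i y⟫_ℝ
  simp only [inner_add_left, inner_add_right, real_inner_smul_left, real_inner_smul_right,
    inner_rightT]

theorem gen_inv (i : Gen) : (gen i)⁻¹ = gen i :=
  inv_eq_of_mul_eq_one_left (gen_mul_self i)

/-- Every property of elements of `W` that holds for `1` and passes from `w` to `w * gen i`
holds on `W`. -/
theorem gen_induction {P : W → Prop} (one : P 1) (mul : ∀ w i, P w → P (w * gen i)) (w : W) :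
    P w := by
  obtain ⟨l, -, rfl⟩ := exists_word _ w rfl
  induction l using List.reverseRecOn with
  | nil => exact one
  | append_singleton l i ih => simpa using mul _ i ih

/-- The group algebra is generated by `s` and `t` under right multiplication. -/
theorem groupAlgebra_induction {P : MonoidAlgebra ℝ W → Prop} (one : P 1)
    (add : ∀ x y, P x → P y → P (x + y)) (smul : ∀ (c : ℝ) x, P x → P (c • x))
    (mul : ∀ x i, P x → P (x * MonoidAlgebra.of ℝ W (gen i))) (x : MonoidAlgebra ℝ W) : P x := by
  refine MonoidAlgebra.induction_on x (fun w => ?_) add smul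
  refine gen_induction (P := fun w => P (MonoidAlgebra.of ℝ W w)) ?_ ?_ w
  · rwa [map_one]
  · intro w i h
    rw [map_mul]
    exact mul _ _ h

/-- Right multiplication by `invol y` is the adjoint of right multiplication by `y`. -/
theorem inner_rightMul (y : MonoidAlgebra ℝ W) (a b : L2) :
    ⟪rightMul q hq y a, b⟫_ℝ = ⟪a, rightMul q hq (invol y) b⟫_ℝ := by
  refine MonoidAlgebra.induction_on
    (motive := fun y => ∀ a b, ⟪rightMul q hq y a, b⟫_ℝ = ⟪a, rightMul q hq (invol y) b⟫_ℝ)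
    y (fun w => ?_) (fun x y hx hy a b => ?_) (fun c x hx a b => ?_) a b
  · refine gen_induction (P := fun w => ∀ a b, ⟪rightMul q hq (MonoidAlgebra.of ℝ W w) a, b⟫_ℝ =
      ⟪a, rightMul q hq (invol (MonoidAlgebra.of ℝ W w)) b⟫_ℝ) (fun a b => ?_)
      (fun w i h a b => ?_) w
    · rw [MonoidAlgebra.of_apply, invol_single, inv_one, ← MonoidAlgebra.one_def, rightMul_one]
      rfl
    · have e : invol (MonoidAlgebra.of ℝ W (w * gen i)) =
          MonoidAlgebra.of ℝ W (gen i) * invol (MonoidAlgebra.of ℝ W w) := by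
        rw [MonoidAlgebra.of_apply, MonoidAlgebra.of_apply, MonoidAlgebra.of_apply, invol_single,
          invol_single, mul_inv_rev, gen_inv, MonoidAlgebra.single_mul_single, one_mul]
      rw [e, map_mul, rightMul_mul, rightMul_mul, ← h, rightMul_gen, inner_rightGen]
  · rw [invol_add, rightMul_add, rightMul_add]
    change ⟪rightMul q hq x a + rightMul q hq y a, b⟫_ℝ =
      ⟪a, rightMul q hq (invol x) b + rightMul q hq (invol y) b⟫_ℝ
    rw [inner_add_left, inner_add_right, hx, hy]
  · rw [invol_smul, rightMul_smul, rightMul_smul]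
    change ⟪c • rightMul q hq x a, b⟫_ℝ = ⟪a, c • rightMul q hq (invol x) b⟫_ℝ
    rw [real_inner_smul_left, real_inner_smul_right, hx]

/-- The unitary involution of `L²_q W` induced by `w ↦ w⁻¹`; it exchanges left and right
multiplication. -/
def flip : L2 →ₗᵢ[ℝ] L2 where
  toFun x := ⟨fun w => x w⁻¹, by
    have h := (lp.memℓp x).summable (by norm_num)
    exact memℓp_gen ((Equiv.inv W).summable_iff.mpr h)⟩
  map_add' _ _ := rfl
  map_smul' _ _ := rfl
  norm_map' x := by
    rw [lp.norm_eq_tsum_rpow (by norm_num), lp.norm_eq_tsum_rpow (by norm_num)]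
    exact congrArg (fun z : ℝ => z ^ (1 / (2 : ENNReal).toReal))
      ((Equiv.inv W).tsum_eq (fun w => ‖x w‖ ^ (2 : ENNReal).toReal))

theorem flip_apply (x : L2) (w : W) : flip x w = x w⁻¹ := rfl

theorem flip_flip (x : L2) : flip (flip x) = x := by
  ext w
  rw [flip_apply, flip_apply, inv_inv]

/-- Left multiplication by the Hecke generator `T_i`. -/
def leftT (i : Gen) (x : L2) : L2 := flip (rightT q i (flip x))

theorem inner_leftT (i : Gen) (x y : L2) : ⟪leftT q i x, y⟫_ℝ = ⟪x, leftT q i y⟫_ℝ := by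
  unfold leftT
  conv_lhs => rw [← flip_flip y]
  conv_rhs => rw [← flip_flip x]
  rw [flip.inner_map_map, flip.inner_map_map, inner_rightT]

theorem wordLength_inv (w : W) : wordLength w⁻¹ = wordLength w := by
  rw [wordLength_eq, wordLength_eq]
  cases w with
  | r j =>
    change 2 * Int.natAbs (-(toInt j)) = 2 * Int.natAbs (toInt j)
    rw [Int.natAbs_neg]
  | sr j => rfl

open Classical in
theorem leftT_apply (i : Gen) (x : L2) (w : W) :
    leftT q i x w = Real.sqrt (q i) * x (gen i * w) +
      (q i - 1) * (if wordLength (gen i * w) < wordLength w then x w else 0) := by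
  unfold leftT
  rw [flip_apply, rightT_apply, flip_apply, flip_apply, mul_inv_rev, inv_inv, gen_inv,
    ← wordLength_inv (w⁻¹ * gen i), mul_inv_rev, inv_inv, gen_inv, wordLength_inv w]

/-- Left and right multiplication by generators change the length independently, except at the
elements `w` with `gen i * w = w * gen j`, which forces `i = j`. -/
theorem wordLength_gen_mul_gen (w : W) (i j : Gen) :
    ((wordLength (gen i * (w * gen j)) < wordLength (w * gen j) ↔
        wordLength (gen i * w) < wordLength w) ∧
      (wordLength (gen i * w * gen j) < wordLength (gen i * w) ↔
        wordLength (w * gen j) < wordLength w)) ∨ (i = j ∧ gen i * w = w * gen j) := by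
  simp only [wordLength_eq]
  cases w with
  | r k =>
    cases i <;> cases j
    · by_cases hk : toInt k = 0
      · right
        refine ⟨rfl, ?_⟩
        change DihedralGroup.sr (0 + k) = DihedralGroup.sr (0 - k)
        rw [show k = 0 from hk]; rfl
      · left
        change ((2 * Int.natAbs (0 - toInt k - 0) < Int.natAbs (2 * (0 - toInt k) - 1) ↔
          Int.natAbs (2 * (0 + toInt k) - 1) < 2 * Int.natAbs (toInt k)) ∧
          (2 * Int.natAbs (0 - (0 + toInt k)) < Int.natAbs (2 * (0 + toInt k) - 1) ↔
          Int.natAbs (2 * (0 - toInt k) - 1) < 2 * Int.natAbs (toInt k)))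
        generalize toInt k = n at hk ⊢
        omega
    · left
      change ((2 * Int.natAbs (1 - toInt k - 0) < Int.natAbs (2 * (1 - toInt k) - 1) ↔
          Int.natAbs (2 * (0 + toInt k) - 1) < 2 * Int.natAbs (toInt k)) ∧
          (2 * Int.natAbs (1 - (0 + toInt k)) < Int.natAbs (2 * (0 + toInt k) - 1) ↔
          Int.natAbs (2 * (1 - toInt k) - 1) < 2 * Int.natAbs (toInt k)))
      generalize toInt k = n
      omega
    · left
      change ((2 * Int.natAbs (0 - toInt k - 1) < Int.natAbs (2 * (0 - toInt k) - 1) ↔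
          Int.natAbs (2 * (1 + toInt k) - 1) < 2 * Int.natAbs (toInt k)) ∧
          (2 * Int.natAbs (0 - (1 + toInt k)) < Int.natAbs (2 * (1 + toInt k) - 1) ↔
          Int.natAbs (2 * (0 - toInt k) - 1) < 2 * Int.natAbs (toInt k)))
      generalize toInt k = n
      omega
    · by_cases hk : toInt k = 0
      · right
        refine ⟨rfl, ?_⟩
        change DihedralGroup.sr (1 + k) = DihedralGroup.sr (1 - k)
        rw [show k = 0 from hk]; rfl
      · left
        change ((2 * Int.natAbs (1 - toInt k - 1) < Int.natAbs (2 * (1 - toInt k) - 1) ↔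
          Int.natAbs (2 * (1 + toInt k) - 1) < 2 * Int.natAbs (toInt k)) ∧
          (2 * Int.natAbs (1 - (1 + toInt k)) < Int.natAbs (2 * (1 + toInt k) - 1) ↔
          Int.natAbs (2 * (1 - toInt k) - 1) < 2 * Int.natAbs (toInt k)))
        generalize toInt k = n at hk ⊢
        omega
  | sr k =>
    cases i <;> cases j
    · by_cases hk : toInt k = 0
      · right
        refine ⟨rfl, ?_⟩
        change DihedralGroup.r (k - 0) = DihedralGroup.r (0 - k)
        rw [show k = 0 from hk]
      · left
        change ((Int.natAbs (2 * (0 + (0 - toInt k)) - 1) < 2 * Int.natAbs (0 - toInt k) ↔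
          2 * Int.natAbs (toInt k - 0) < Int.natAbs (2 * toInt k - 1)) ∧
          (Int.natAbs (2 * (0 - (toInt k - 0)) - 1) < 2 * Int.natAbs (toInt k - 0) ↔
          2 * Int.natAbs (0 - toInt k) < Int.natAbs (2 * toInt k - 1)))
        generalize toInt k = n at hk ⊢
        omega
    · left
      change ((Int.natAbs (2 * (0 + (1 - toInt k)) - 1) < 2 * Int.natAbs (1 - toInt k) ↔
          2 * Int.natAbs (toInt k - 0) < Int.natAbs (2 * toInt k - 1)) ∧
          (Int.natAbs (2 * (1 - (toInt k - 0)) - 1) < 2 * Int.natAbs (toInt k - 0) ↔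
          2 * Int.natAbs (1 - toInt k) < Int.natAbs (2 * toInt k - 1)))
      generalize toInt k = n
      omega
    · left
      change ((Int.natAbs (2 * (1 + (0 - toInt k)) - 1) < 2 * Int.natAbs (0 - toInt k) ↔
          2 * Int.natAbs (toInt k - 1) < Int.natAbs (2 * toInt k - 1)) ∧
          (Int.natAbs (2 * (0 - (toInt k - 1)) - 1) < 2 * Int.natAbs (toInt k - 1) ↔
          2 * Int.natAbs (0 - toInt k) < Int.natAbs (2 * toInt k - 1)))
      generalize toInt k = n
      omega
    · by_cases hk : toInt k = 1
      · right
        refine ⟨rfl, ?_⟩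
        change DihedralGroup.r (k - 1) = DihedralGroup.r (1 - k)
        rw [show k = 1 from hk]
      · left
        change ((Int.natAbs (2 * (1 + (1 - toInt k)) - 1) < 2 * Int.natAbs (1 - toInt k) ↔
          2 * Int.natAbs (toInt k - 1) < Int.natAbs (2 * toInt k - 1)) ∧
          (Int.natAbs (2 * (1 - (toInt k - 1)) - 1) < 2 * Int.natAbs (toInt k - 1) ↔
          2 * Int.natAbs (1 - toInt k) < Int.natAbs (2 * toInt k - 1)))
        generalize toInt k = n at hk ⊢
        omega

theorem gen_mul_gen_mul (w : W) (i : Gen) : gen i * (gen i * w) = w := by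
  rw [← mul_assoc, gen_mul_self, one_mul]

theorem leftT_rightT (i j : Gen) (x : L2) :
    leftT q i (rightT q j x) = rightT q j (leftT q i x) := by
  classical
  ext w
  simp only [leftT_apply, rightT_apply]
  rcases wordLength_gen_mul_gen w i j with ⟨h1, h2⟩ | ⟨rfl, h⟩
  · simp only [mul_assoc (gen i)] at h1 h2 ⊢
    simp only [h1, h2]
    split_ifs <;> ring
  · have h3 : gen i * (w * gen i) = w := by rw [← h, gen_mul_gen_mul]
    simp only [h3, h, mul_gen_mul_gen]

theorem leftT_add (i : Gen) (x y : L2) : leftT q i (x + y) = leftT q i x + leftT q i y := by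
  unfold leftT; rw [map_add, map_add, map_add]

theorem leftT_smul (i : Gen) (c : ℝ) (x : L2) : leftT q i (c • x) = c • leftT q i x := by
  unfold leftT; rw [map_smul, map_smul, map_smul]

theorem leftT_rightMul (i : Gen) (y : MonoidAlgebra ℝ W) (x : L2) :
    leftT q i (rightMul q hq y x) = rightMul q hq y (leftT q i x) := by
  refine groupAlgebra_induction
    (P := fun y => ∀ x, leftT q i (rightMul q hq y x) = rightMul q hq y (leftT q i x))
    (fun x => ?_) (fun a b ha hb x => ?_) (fun c a ha x => ?_) (fun a j ha x => ?_) y x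
  · rw [rightMul_one]; rfl
  · rw [rightMul_add]
    change leftT q i (rightMul q hq a x + rightMul q hq b x) = rightMul q hq a _ + rightMul q hq b _
    rw [leftT_add, ha, hb]
  · rw [rightMul_smul]
    change leftT q i (c • rightMul q hq a x) = c • rightMul q hq a _
    rw [leftT_smul, ha]
  · rw [rightMul_mul, rightMul_mul, ← ha, rightMul_gen]
    change leftT q i (((1 - q j) / (1 + q j)) • _ + (2 / (1 + q j)) • rightT q j _) =
      ((1 - q j) / (1 + q j)) • _ + (2 / (1 + q j)) • rightT q j _
    rw [leftT_add, leftT_smul, leftT_smul, leftT_rightT]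
    rfl

theorem leftT_T_one (i : Gen) : leftT q i (T q 1) = rightT q i (T q 1) := by
  classical
  have h : flip (T q 1) = T q 1 := by
    ext w
    rw [flip_apply]
    simp only [T, lp.single_apply, Pi.single_apply, inv_eq_one]
  ext w
  rw [leftT, flip_apply, h, rightT_apply, rightT_apply]
  have e : ∀ v : W, T q 1 v⁻¹ = T q 1 v := fun v => by
    rw [← flip_apply, h]
  have e2 : T q 1 (w⁻¹ * gen i) = T q 1 (w * gen i) := by
    rw [← e (w * gen i), mul_inv_rev, gen_inv]
    have e3 : gen i = w⁻¹⁻¹ ↔ w⁻¹ = gen i := by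
      rw [inv_inv, inv_eq_iff_eq_inv, gen_inv, eq_comm]
    simp only [T, lp.single_apply, Pi.single_apply, mul_eq_one_iff_eq_inv, gen_inv, e3]
  rw [e, e2]
  by_cases hw : w = 1
  · rw [hw, inv_one]
  · have : T q 1 w = 0 := by simp [T, lp.single_apply, hw]
    simp [this]

/-- The trace `y ↦ ⟨y, 1⟩` on `ℝW` given by the inner product of `L²_q W`. -/
def tau : MonoidAlgebra ℝ W →ₗ[ℝ] ℝ where
  toFun y := ⟪rightMul q hq y (T q 1), T q 1⟫_ℝ
  map_add' x y := by
    rw [rightMul_add, ← inner_add_left]; rfl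
  map_smul' c x := by
    rw [rightMul_smul, RingHom.id_apply, smul_eq_mul, ← real_inner_smul_left]; rfl

theorem tau_apply (y : MonoidAlgebra ℝ W) :
    tau q hq y = ⟪rightMul q hq y (T q 1), T q 1⟫_ℝ := rfl

theorem tau_mul_tauGen (y : MonoidAlgebra ℝ W) (i : Gen) :
    tau q hq (y * tauGen q i) = tau q hq (tauGen q i * y) := by
  rw [tau_apply, tau_apply, rightMul_mul, rightMul_mul, rightMul_tauGen, inner_rightT,
    ← leftT_T_one, ← inner_leftT, leftT_rightMul]

/-- `tau` is a trace. It suffices to check this for the Hecke generators, where it holds because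
left and right multiplication by `T_i` are self-adjoint, commute, and agree on `T_1`. -/
theorem tau_mul_comm (x y : MonoidAlgebra ℝ W) : tau q hq (x * y) = tau q hq (y * x) := by
  refine groupAlgebra_induction (P := fun y => ∀ x, tau q hq (x * y) = tau q hq (y * x))
    (fun x => ?_) (fun a b ha hb x => ?_) (fun c a ha x => ?_) (fun a i ha x => ?_) y x
  · rw [mul_one, one_mul]
  · rw [mul_add, add_mul, map_add, map_add, ha, hb]
  · rw [mul_smul_comm, smul_mul_assoc, map_smul, map_smul, ha]
  · have key : ∀ y, tau q hq (y * MonoidAlgebra.of ℝ W (gen i)) =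
        tau q hq (MonoidAlgebra.of ℝ W (gen i) * y) := fun y => by
      have h := tau_mul_tauGen q hq y i
      unfold tauGen at h
      rw [mul_add, add_mul, mul_smul_comm, smul_mul_assoc, mul_one, one_mul, mul_smul_comm,
        smul_mul_assoc, map_add, map_add] at h
      have h' := add_left_cancel h
      rw [map_smul, map_smul] at h'
      have h2 : (q i + 1) / 2 ≠ 0 := by have := hq i; positivity
      exact mul_left_cancel₀ h2 h'
    rw [← mul_assoc, key, ← mul_assoc, ha, mul_assoc]

theorem inner_T_one_T_one : ⟪T q 1, T q 1⟫_ℝ = 1 := by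
  classical
  have h : ⟪T q 1, T q 1⟫_ℝ = ⟪Real.sqrt (qpow q 1), T q 1 1⟫_ℝ := lp.inner_single_left _ _ _
  rw [h, T, lp.single_apply, Pi.single_apply, if_pos rfl, qpow_one, Real.sqrt_one]
  simp

theorem tau_one : tau q hq 1 = 1 := by
  rw [tau_apply, rightMul_one]
  exact inner_T_one_T_one q

theorem tau_gen (i : Gen) :
    tau q hq (MonoidAlgebra.of ℝ W (gen i)) = (1 - q i) / (1 + q i) := by
  rw [tau_apply, rightMul_gen]
  change ⟪((1 - q i) / (1 + q i)) • T q 1 + (2 / (1 + q i)) • rightT q i (T q 1), T q 1⟫_ℝ = _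
  have h1 : wordLength 1 < wordLength (1 * gen i) := by
    rw [wordLength_eq, wordLength_eq]
    cases i <;> decide
  have h2 : 1 * gen i ≠ 1 := fun h => by rw [h] at h1; exact lt_irrefl _ h1
  rw [rightT_T q hq, if_pos h1, inner_add_left, real_inner_smul_left, real_inner_smul_left,
    inner_T_T q hq, inner_T_T q hq, if_pos rfl, if_neg h2, qpow_one]
  ring

end RightMul

/-! ### The rank of a matrix over `ℝW` -/

section Rank

open Filter Topology

variable (q : Gen → ℝ) (hq : ∀ i, 0 < q i)

/-- The adjoint matrix over `ℝW`: the transpose with the involution applied to the entries. -/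
def adj {m n : ℕ} (M : Matrix (Fin m) (Fin n) (MonoidAlgebra ℝ W)) :
    Matrix (Fin n) (Fin m) (MonoidAlgebra ℝ W) :=
  M.transpose.map invol

theorem adj_adj {m n : ℕ} (M : Matrix (Fin m) (Fin n) (MonoidAlgebra ℝ W)) : adj (adj M) = M := by
  ext1 i j
  exact invol_invol (M i j)

theorem rightMulMatrix_mul {m n p : ℕ} (M : Matrix (Fin m) (Fin n) (MonoidAlgebra ℝ W))
    (N : Matrix (Fin n) (Fin p) (MonoidAlgebra ℝ W)) (x : L2Pow m) :
    rightMulMatrix q hq (M * N) x = rightMulMatrix q hq N (rightMulMatrix q hq M x) := by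
  ext1 k
  simp only [rightMulMatrix_apply, Matrix.mul_apply, rightMul_sum, sum_apply, rightMul_mul,
    map_sum]
  exact Finset.sum_comm

theorem rightMulMatrix_one {m : ℕ} (x : L2Pow m) :
    rightMulMatrix q hq (1 : Matrix (Fin m) (Fin m) (MonoidAlgebra ℝ W)) x = x := by
  ext1 j
  rw [rightMulMatrix_apply, Finset.sum_eq_single j]
  · rw [Matrix.one_apply_eq, rightMul_one]; rfl
  · intro i _ hij
    rw [Matrix.one_apply_ne hij, rightMul_zero]; rfl
  · simp

theorem rightMulMatrix_sub {m n : ℕ} (M N : Matrix (Fin m) (Fin n) (MonoidAlgebra ℝ W))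
    (x : L2Pow m) :
    rightMulMatrix q hq (M - N) x = rightMulMatrix q hq M x - rightMulMatrix q hq N x := by
  ext1 j
  rw [PiLp.sub_apply]
  simp only [rightMulMatrix_apply, Matrix.sub_apply, rightMul_sub, sub_apply,
    Finset.sum_sub_distrib]

theorem rightMulMatrix_smul {m n : ℕ} (c : ℝ) (M : Matrix (Fin m) (Fin n) (MonoidAlgebra ℝ W))
    (x : L2Pow m) : rightMulMatrix q hq (c • M) x = c • rightMulMatrix q hq M x := by
  ext1 j
  rw [PiLp.smul_apply]
  simp only [rightMulMatrix_apply, Matrix.smul_apply, rightMul_smul, smul_apply,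
    Finset.smul_sum]

theorem inner_rightMulMatrix {m n : ℕ} (M : Matrix (Fin m) (Fin n) (MonoidAlgebra ℝ W))
    (x : L2Pow m) (y : L2Pow n) :
    ⟪rightMulMatrix q hq M x, y⟫_ℝ = ⟪x, rightMulMatrix q hq (adj M) y⟫_ℝ := by
  simp only [PiLp.inner_apply, rightMulMatrix_apply, sum_inner, inner_sum, inner_rightMul]
  exact Finset.sum_comm

theorem rightMulMatrix_pow {m : ℕ} (M : Matrix (Fin m) (Fin m) (MonoidAlgebra ℝ W)) (k : ℕ)
    (x : L2Pow m) : rightMulMatrix q hq (M ^ k) x = (rightMulMatrix q hq M)^[k] x := by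
  induction k with
  | zero => rw [pow_zero, rightMulMatrix_one]; rfl
  | succ k ih => rw [pow_succ, rightMulMatrix_mul, ih, Function.iterate_succ_apply']

theorem stdBasis_apply {m : ℕ} (i j : Fin m) :
    (stdBasis q i : L2Pow m) j = if j = i then T q 1 else 0 := by
  change (Pi.single i (T q 1) : Fin m → L2) j = _
  rw [Pi.single_apply]

theorem inner_stdBasis {m : ℕ} (x : L2Pow m) (i : Fin m) :
    ⟪x, stdBasis q i⟫_ℝ = ⟪x i, T q 1⟫_ℝ := by
  rw [PiLp.inner_apply, Finset.sum_eq_single i]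
  · rw [stdBasis_apply, if_pos rfl]
  · intro j _ hj
    rw [stdBasis_apply, if_neg hj, inner_zero_right]
  · simp

theorem rightMulMatrix_stdBasis {m n : ℕ} (M : Matrix (Fin m) (Fin n) (MonoidAlgebra ℝ W))
    (i : Fin m) (j : Fin n) :
    rightMulMatrix q hq M (stdBasis q i) j = rightMul q hq (M i j) (T q 1) := by
  rw [rightMulMatrix_apply, Finset.sum_eq_single i]
  · rw [stdBasis_apply, if_pos rfl]
  · intro k _ hk
    rw [stdBasis_apply, if_neg hk, map_zero]
  · simp

theorem sum_inner_stdBasis {m : ℕ} (M : Matrix (Fin m) (Fin m) (MonoidAlgebra ℝ W)) :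
    ∑ i, ⟪rightMulMatrix q hq M (stdBasis q i), stdBasis q i⟫_ℝ = tau q hq M.trace := by
  simp only [inner_stdBasis, rightMulMatrix_stdBasis, Matrix.trace, Matrix.diag, map_sum,
    tau_apply]

theorem tau_trace_mul_comm {m n : ℕ} (M : Matrix (Fin m) (Fin n) (MonoidAlgebra ℝ W))
    (N : Matrix (Fin n) (Fin m) (MonoidAlgebra ℝ W)) :
    tau q hq (M * N).trace = tau q hq (N * M).trace := by
  simp only [Matrix.trace, Matrix.diag, Matrix.mul_apply, map_sum]
  rw [Finset.sum_comm]
  simp only [tau_mul_comm q hq (M _ _) (N _ _)]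

theorem mem_kerRightMul {m n : ℕ} {M : Matrix (Fin m) (Fin n) (MonoidAlgebra ℝ W)}
    {x : L2Pow m} : x ∈ kerRightMul q hq M ↔ rightMulMatrix q hq M x = 0 := Iff.rfl

/-- The dimension of `ker R_M` is a Cesàro limit of traces of powers of the contraction
`1 - c M M*`, whose fixed space is `ker R_M`, by the mean ergodic theorem. -/
theorem tendsto_heckeDim {m n : ℕ} (M : Matrix (Fin m) (Fin n) (MonoidAlgebra ℝ W)) {c : ℝ}
    (hc : 0 < c) (hcM : c * ‖rightMulMatrix q hq (adj M)‖ ^ 2 ≤ 2) :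
    Tendsto (fun N : ℕ => (N : ℝ)⁻¹ * ∑ k ∈ Finset.range N,
      tau q hq (((1 - c • (M * adj M)) ^ k).trace)) atTop
      (𝓝 (heckeDim q (kerRightMul q hq M))) := by
  set A := rightMulMatrix q hq M with hA
  set B := rightMulMatrix q hq (adj M) with hB
  set f := rightMulMatrix q hq (1 - c • (M * adj M)) with hf
  have hfx : ∀ x, f x = x - c • B (A x) := fun x => by
    rw [hf, rightMulMatrix_sub, rightMulMatrix_one, rightMulMatrix_smul, rightMulMatrix_mul]
  have hAB : ∀ x y, ⟪A x, y⟫_ℝ = ⟪x, B y⟫_ℝ := fun x y => inner_rightMulMatrix q hq M x y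
  have hnorm : ‖f‖ ≤ 1 := by
    refine ContinuousLinearMap.opNorm_le_bound _ zero_le_one fun x => ?_
    rw [one_mul]
    refine le_of_sq_le_sq ?_ (norm_nonneg x)
    have h1 : ‖f x‖ ^ 2 = ‖x‖ ^ 2 - 2 * c * ‖A x‖ ^ 2 + c ^ 2 * ‖B (A x)‖ ^ 2 := by
      rw [hfx, norm_sub_sq_real, real_inner_smul_right, ← hAB, real_inner_self_eq_norm_sq,
        norm_smul, Real.norm_eq_abs, mul_pow, sq_abs]
      ring
    have h2 : ‖B (A x)‖ ^ 2 ≤ ‖B‖ ^ 2 * ‖A x‖ ^ 2 := by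
      rw [← mul_pow]
      exact pow_le_pow_left₀ (norm_nonneg _) (B.le_opNorm _) 2
    have h3 : c ^ 2 * ‖B (A x)‖ ^ 2 ≤ 2 * c * ‖A x‖ ^ 2 := by
      calc c ^ 2 * ‖B (A x)‖ ^ 2 ≤ c ^ 2 * (‖B‖ ^ 2 * ‖A x‖ ^ 2) := by gcongr
        _ = (c * ‖B‖ ^ 2) * (c * ‖A x‖ ^ 2) := by ring
        _ ≤ 2 * (c * ‖A x‖ ^ 2) := by gcongr
        _ = 2 * c * ‖A x‖ ^ 2 := by ring
    linarith
  have hfix : ∀ x, f x = x ↔ x ∈ kerRightMul q hq M := fun x => by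
    rw [hfx, sub_eq_self, smul_eq_zero, or_iff_right hc.ne', mem_kerRightMul]
    constructor
    · intro h
      rw [← hA, ← inner_self_eq_zero (𝕜 := ℝ), hAB, h, inner_zero_right]
    · intro h
      rw [← hA] at h
      rw [h, map_zero]
  have hproj : ∀ x, Tendsto (birkhoffAverage ℝ f _root_.id · x) atTop
      (𝓝 ((kerRightMul q hq M).starProjection x)) := fun x => by
    have h := f.tendsto_birkhoffAverage_orthogonalProjection hnorm x
    have e : kerRightMul q hq M = f.eqLocus (1 : L2Pow m →L[ℝ] L2Pow m) := by
      ext x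
      rw [← hfix]
      rfl
    simp only [e]
    exact h
  have hlim := tendsto_finsetSum (Finset.univ : Finset (Fin m)) fun i _ =>
    Filter.Tendsto.inner (𝕜 := ℝ) (hproj (stdBasis q i))
      (tendsto_const_nhds (x := (stdBasis q i : L2Pow m)))
  refine hlim.congr fun N => ?_
  simp only [← sum_inner_stdBasis, birkhoffAverage, birkhoffSum, real_inner_smul_left, sum_inner,
    ← Finset.mul_sum, rightMulMatrix_pow, id]
  rw [Finset.sum_comm]

theorem exists_pow_one_sub {R : Type*} [CommRing R] {A : Type*} [Ring A] [Algebra R A] {m n : ℕ}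
    (X : Matrix (Fin m) (Fin n) A) (Y : Matrix (Fin n) (Fin m) A) (c : R) (k : ℕ) :
    ∃ g : Matrix (Fin n) (Fin n) A, (1 - c • (X * Y)) ^ k = 1 + X * (g * Y) ∧
      (1 - c • (Y * X)) ^ k = 1 + g * Y * X := by
  induction k with
  | zero => exact ⟨0, by simp, by simp⟩
  | succ k ih =>
    obtain ⟨g, h1, h2⟩ := ih
    refine ⟨g - c • 1 - c • (g * Y * X), ?_, ?_⟩
    · rw [pow_succ, h1]
      simp only [mul_sub, add_mul, mul_one, one_mul, Matrix.mul_sub, Matrix.sub_mul,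
        Matrix.mul_smul, Matrix.smul_mul, Matrix.one_mul, Matrix.mul_assoc]
      abel
    · rw [pow_succ, h2]
      simp only [mul_sub, add_mul, mul_one, one_mul, Matrix.sub_mul,
        Matrix.mul_smul, Matrix.smul_mul, Matrix.one_mul, Matrix.mul_assoc]
      abel

/-- The rank of `R_M`: the von Neumann codimension of its kernel. -/
def rank {m n : ℕ} (M : Matrix (Fin m) (Fin n) (MonoidAlgebra ℝ W)) : ℝ :=
  m - heckeDim q (kerRightMul q hq M)

theorem tau_trace_one (m : ℕ) :
    tau q hq (1 : Matrix (Fin m) (Fin m) (MonoidAlgebra ℝ W)).trace = m := by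
  rw [Matrix.trace_one, Fintype.card_fin, ← nsmul_one, map_nsmul, tau_one, nsmul_one]

/-- Row rank equals column rank: as `tau` is a trace, the powers of `1 - c M M*` and of
`1 - c M* M` have the same trace up to the difference `m - n`. -/
theorem rank_adj {m n : ℕ} (M : Matrix (Fin m) (Fin n) (MonoidAlgebra ℝ W)) :
    rank q hq (adj M) = rank q hq M := by
  set a := ‖rightMulMatrix q hq M‖
  set b := ‖rightMulMatrix q hq (adj M)‖
  set c := 2 / (1 + a ^ 2 + b ^ 2) with hc
  have hd : 0 < 1 + a ^ 2 + b ^ 2 := by positivity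
  have hc0 : 0 < c := by positivity
  have h1 := tendsto_heckeDim q hq M hc0 (by
    rw [hc, div_mul_eq_mul_div, div_le_iff₀ hd]; nlinarith [sq_nonneg a])
  have h2 := tendsto_heckeDim q hq (adj M) hc0 (by
    rw [adj_adj, hc, div_mul_eq_mul_div, div_le_iff₀ hd]; nlinarith [sq_nonneg b])
  rw [adj_adj] at h2
  have h3 : ∀ k, tau q hq (((1 - c • (M * adj M)) ^ k).trace) =
      tau q hq (((1 - c • (adj M * M)) ^ k).trace) + ((m : ℝ) - n) := fun k => by
    obtain ⟨g, e1, e2⟩ := exists_pow_one_sub M (adj M) c k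
    rw [e1, e2, Matrix.trace_add, Matrix.trace_add, map_add, map_add, tau_trace_one, tau_trace_one,
      tau_trace_mul_comm]
    ring
  have h4 := h2.add_const ((m : ℝ) - n)
  have h5 : heckeDim q (kerRightMul q hq M) =
      heckeDim q (kerRightMul q hq (adj M)) + ((m : ℝ) - n) := by
    refine tendsto_nhds_unique h1 (h4.congr' ?_)
    filter_upwards [eventually_gt_atTop 0] with N hN
    have hN' : (N : ℝ) ≠ 0 := by positivity
    simp only [h3, Finset.sum_add_distrib, Finset.sum_const, Finset.card_range, nsmul_eq_mul]
    rw [mul_add, inv_mul_cancel_left₀ hN']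
  unfold rank
  rw [h5]
  ring

theorem heckeDim_mono {m : ℕ} (V V' : Submodule ℝ (L2Pow m)) [V.HasOrthogonalProjection]
    [V'.HasOrthogonalProjection] (h : V ≤ V') : heckeDim q V ≤ heckeDim q V' := by
  refine Finset.sum_le_sum fun i _ => ?_
  have key : ∀ (U : Submodule ℝ (L2Pow m)) [U.HasOrthogonalProjection] (x : L2Pow m),
      ⟪U.starProjection x, x⟫_ℝ = ‖U.starProjection x‖ ^ 2 := fun U _ x => by
    rw [← real_inner_self_eq_norm_sq, ← sub_eq_zero, ← inner_sub_right, real_inner_comm]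
    exact U.starProjection_inner_eq_zero x _ (U.starProjection_apply_mem x)
  rw [key, key]
  have h2 : V.starProjection (stdBasis q i) =
      V.starProjection (V'.starProjection (stdBasis q i)) := by
    refine V.eq_starProjection_of_mem_of_inner_eq_zero (V.starProjection_apply_mem _) fun w hw => ?_
    rw [← sub_add_sub_cancel _ (V'.starProjection (stdBasis q i)), inner_add_left,
      V'.starProjection_inner_eq_zero _ _ (h hw), V.starProjection_inner_eq_zero _ _ hw, add_zero]
  rw [h2]
  exact pow_le_pow_left₀ (norm_nonneg _) (V.norm_starProjection_apply_le _) 2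

theorem heckeDim_congr {m : ℕ} {V V' : Submodule ℝ (L2Pow m)} [V.HasOrthogonalProjection]
    [V'.HasOrthogonalProjection] (h : V = V') : heckeDim q V = heckeDim q V' :=
  le_antisymm (heckeDim_mono q _ _ h.le) (heckeDim_mono q _ _ h.ge)

theorem rank_mul_le_left {m n p : ℕ} (M : Matrix (Fin m) (Fin n) (MonoidAlgebra ℝ W))
    (N : Matrix (Fin n) (Fin p) (MonoidAlgebra ℝ W)) :
    rank q hq (M * N) ≤ rank q hq M := by
  refine sub_le_sub_left (heckeDim_mono q _ _ fun x hx => ?_) _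
  rw [mem_kerRightMul] at hx ⊢
  rw [rightMulMatrix_mul, hx, map_zero]

theorem adj_mul {m n p : ℕ} (M : Matrix (Fin m) (Fin n) (MonoidAlgebra ℝ W))
    (N : Matrix (Fin n) (Fin p) (MonoidAlgebra ℝ W)) : adj (M * N) = adj N * adj M := by
  ext1 i j
  simp only [adj, Matrix.map_apply, Matrix.transpose_apply, Matrix.mul_apply, invol_sum, invol_mul]

theorem rank_mul_le_right {m n p : ℕ} (M : Matrix (Fin m) (Fin n) (MonoidAlgebra ℝ W))
    (N : Matrix (Fin n) (Fin p) (MonoidAlgebra ℝ W)) :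
    rank q hq (M * N) ≤ rank q hq N := by
  rw [← rank_adj q hq (M * N), ← rank_adj q hq N, adj_mul]
  exact rank_mul_le_left q hq _ _

/-- The rank of `R_M` for the diagonal matrix with all entries `y`, relative to its value for
the `1 × 1` matrix `y`. -/
theorem rank_scalar (y : MonoidAlgebra ℝ W) (m : ℕ) :
    rank q hq (Matrix.scalar (Fin m) y) = m * rank q hq (Matrix.scalar (Fin 1) y) := by
  have hker : ∀ {k : ℕ} (x : L2Pow k) (j : Fin k),
      rightMulMatrix q hq (Matrix.scalar (Fin k) y) x j = rightMul q hq y (x j) := fun x j => by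
    rw [rightMulMatrix_apply, Finset.sum_eq_single j]
    · simp
    · intro i _ hij
      simp [Matrix.scalar_apply, Matrix.diagonal_apply_ne _ hij, rightMul_zero]
    · simp
  let K : Submodule ℝ L2 := LinearMap.ker (rightMul q hq y).toLinearMap
  have : CompleteSpace K :=
    (ContinuousLinearMap.isClosed_ker (rightMul q hq y)).completeSpace_coe
  have : K.HasOrthogonalProjection := Submodule.HasOrthogonalProjection.ofCompleteSpace _
  have hmem : ∀ {k : ℕ} (x : L2Pow k), x ∈ kerRightMul q hq (Matrix.scalar (Fin k) y) ↔
      ∀ j, x j ∈ K := fun {k} x => by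
    rw [mem_kerRightMul]
    constructor
    · intro h j
      change rightMul q hq y (x j) = 0
      rw [← hker, h]; rfl
    · intro h
      ext1 j
      rw [hker]
      exact h j
  have hdim : ∀ k : ℕ, heckeDim q (kerRightMul q hq (Matrix.scalar (Fin k) y)) =
      k * ⟪K.starProjection (T q 1), T q 1⟫_ℝ := fun k => by
    unfold heckeDim
    rw [Finset.sum_eq_card_nsmul (b := ⟪K.starProjection (T q 1), T q 1⟫_ℝ), Finset.card_univ,
      Fintype.card_fin, nsmul_eq_mul]
    intro i _
    have e : (kerRightMul q hq (Matrix.scalar (Fin k) y)).starProjection (stdBasis q i) =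
        WithLp.toLp 2 (fun j => K.starProjection (stdBasis q i j)) := by
      refine Submodule.eq_starProjection_of_mem_of_inner_eq_zero ?_ fun w hw => ?_
      · rw [hmem]
        exact fun j => K.starProjection_apply_mem _
      · rw [PiLp.inner_apply]
        exact Finset.sum_eq_zero fun j _ =>
          K.starProjection_inner_eq_zero _ _ ((hmem w).mp hw j)
    rw [e, inner_stdBasis]
    change ⟪K.starProjection (stdBasis q i i), T q 1⟫_ℝ = _
    rw [stdBasis_apply, if_pos rfl]
  unfold rank
  rw [hdim, hdim, Nat.cast_one]
  ring

end Rank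

/-! ### The central element `st + ts` and its eigenvectors -/

section Spectral

open Filter Topology

variable (q : Gen → ℝ) (hq : ∀ i, 0 < q i)

/-- The rotation `(st)^i` of `W`. -/
def rot (i : ℤ) : W := DihedralGroup.r (show ZMod 0 from i)

/-- The reflection `s (st)^i` of `W`. -/
def refl (i : ℤ) : W := DihedralGroup.sr (show ZMod 0 from i)

theorem rot_zero : rot 0 = 1 := rfl

theorem rightT_s_rot (x : L2) (i : ℤ) : rightT q Gen.s x (rot i) =
    Real.sqrt (q Gen.s) * x (refl (-i)) + (q Gen.s - 1) * (if i < 0 then x (rot i) else 0) := by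
  classical
  have e : rot i * gen Gen.s = refl (-i) := congrArg refl (zero_sub i)
  have h : wordLength (refl (-i)) < wordLength (rot i) ↔ i < 0 := by
    rw [wordLength_eq, wordLength_eq]
    change Int.natAbs (2 * (-i) - 1) < 2 * Int.natAbs i ↔ _
    omega
  rw [rightT_apply, e]
  simp only [h]

theorem rightT_t_rot (x : L2) (i : ℤ) : rightT q Gen.t x (rot i) =
    Real.sqrt (q Gen.t) * x (refl (1 - i)) + (q Gen.t - 1) * (if 0 < i then x (rot i) else 0) := by
  classical
  have e : rot i * gen Gen.t = refl (1 - i) := rfl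
  have h : wordLength (refl (1 - i)) < wordLength (rot i) ↔ 0 < i := by
    rw [wordLength_eq, wordLength_eq]
    change Int.natAbs (2 * (1 - i) - 1) < 2 * Int.natAbs i ↔ _
    omega
  rw [rightT_apply, e]
  simp only [h]

theorem rightT_t_refl (x : L2) (i : ℤ) : rightT q Gen.t x (refl i) =
    Real.sqrt (q Gen.t) * x (rot (1 - i)) + (q Gen.t - 1) * (if 0 < i then x (refl i) else 0) := by
  classical
  have e : refl i * gen Gen.t = rot (1 - i) := rfl
  have h : wordLength (rot (1 - i)) < wordLength (refl i) ↔ 0 < i := by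
    rw [wordLength_eq, wordLength_eq]
    change 2 * Int.natAbs (1 - i) < Int.natAbs (2 * i - 1) ↔ _
    omega
  rw [rightT_apply, e]
  simp only [h]

theorem rot_injective : Function.Injective rot := fun _ _ h => DihedralGroup.r.inj h

theorem summable_sq (x : L2) : Summable fun w => x w ^ 2 := by
  have h := (lp.memℓp x).summable (by norm_num)
  refine h.congr fun w => ?_
  simp

/-- Square-summable functions tend to zero along injective sequences. -/
theorem tendsto_comp_injective (x : L2) {f : ℕ → W} (hf : Function.Injective f) :
    Tendsto (fun n => x (f n)) atTop (𝓝 0) := by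
  have h := ((summable_sq x).comp_injective hf).tendsto_atTop_zero
  have h2 := h.sqrt
  simp only [Function.comp_def, Real.sqrt_zero, Real.sqrt_sq_eq_abs] at h2
  exact (tendsto_zero_iff_abs_tendsto_zero _).mpr h2

/-- A null sequence satisfying a symmetric second order recurrence is geometric: the quadratic
form `a_{n+1}² - τ a_n a_{n+1} + a_n²` does not depend on `n`, hence vanishes. -/
theorem geometric_of_tendsto_zero {a : ℕ → ℝ} {τ : ℝ} (ha : Tendsto a atTop (𝓝 0))
    (hrec : ∀ n, a n + a (n + 2) = τ * a (n + 1)) :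
    (a 0 = 0 ∧ ∀ n, a n = 0) ∨
      ∃ p, |p| < 1 ∧ p ^ 2 - τ * p + 1 = 0 ∧ ∀ n, a n = p ^ n * a 0 := by
  have hQ : ∀ n, a (n + 1) ^ 2 - τ * a n * a (n + 1) + a n ^ 2 =
      a 1 ^ 2 - τ * a 0 * a 1 + a 0 ^ 2 := fun n => by
    induction n with
    | zero => rfl
    | succ n ih =>
      rw [← ih]
      linear_combination (a (n + 2) - a n) * hrec n
  have ha1 : Tendsto (fun n => a (n + 1)) atTop (𝓝 0) := (tendsto_add_atTop_iff_nat 1).mpr ha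
  have hlim : Tendsto (fun n => a (n + 1) ^ 2 - τ * a n * a (n + 1) + a n ^ 2) atTop
      (𝓝 (0 ^ 2 - τ * 0 * 0 + 0 ^ 2)) :=
    ((ha1.pow 2).sub ((ha.const_mul τ).mul ha1)).add (ha.pow 2)
  have h0 : a 1 ^ 2 - τ * a 0 * a 1 + a 0 ^ 2 = 0 := by
    simp only [hQ] at hlim
    simpa using tendsto_nhds_unique tendsto_const_nhds hlim
  by_cases h : a 0 = 0
  · left
    have h1 : a 1 = 0 := by
      rw [h] at h0
      simpa using h0
    refine ⟨h, fun n => ?_⟩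
    have : a n = 0 ∧ a (n + 1) = 0 := by
      induction n with
      | zero => exact ⟨h, h1⟩
      | succ n ih =>
        refine ⟨ih.2, ?_⟩
        have := hrec n
        rw [ih.1, ih.2] at this
        linarith
    exact this.1
  · right
    have hp : (a 1 / a 0) ^ 2 - τ * (a 1 / a 0) + 1 = 0 := by
      field_simp
      linear_combination h0
    have hn : ∀ n, a n = (a 1 / a 0) ^ n * a 0 ∧ a (n + 1) = (a 1 / a 0) ^ (n + 1) * a 0 := by
      intro n
      induction n with
      | zero => exact ⟨by simp, by rw [zero_add, pow_one, div_mul_cancel₀ _ h]⟩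
      | succ n ih =>
        refine ⟨ih.2, ?_⟩
        have := hrec n
        rw [ih.1, ih.2] at this
        linear_combination this - (a 1 / a 0) ^ n * a 0 * hp
    refine ⟨a 1 / a 0, ?_, hp, fun n => (hn n).1⟩
    have h2 : Tendsto (fun n => (a 1 / a 0) ^ n) atTop (𝓝 0) := by
      have := ha.mul_const (a 0)⁻¹
      rw [zero_mul] at this
      refine this.congr fun n => ?_
      rw [(hn n).1, mul_inv_cancel_right₀ h]
    exact tendsto_pow_atTop_nhds_zero_iff.mp h2

/-- The group algebra element `st + ts`; it is central and generates the centre. -/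
def zed : MonoidAlgebra ℝ W :=
  MonoidAlgebra.of ℝ W (gen Gen.s) * MonoidAlgebra.of ℝ W (gen Gen.t) +
    MonoidAlgebra.of ℝ W (gen Gen.t) * MonoidAlgebra.of ℝ W (gen Gen.s)

theorem of_gen_mul_self (i : Gen) :
    MonoidAlgebra.of ℝ W (gen i) * MonoidAlgebra.of ℝ W (gen i) = 1 := by
  rw [← map_mul, gen_mul_self, map_one]

theorem rightGen_rightGen (hq : ∀ i, 0 < q i) (i : Gen) (x : L2) :
    rightGen q i (rightGen q i x) = x :=
  DFunLike.congr_fun (rightGen_mul_self q hq i) x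

theorem rightMul_zed (x : L2) : rightMul q hq zed x =
    rightGen q Gen.t (rightGen q Gen.s x) + rightGen q Gen.s (rightGen q Gen.t x) := by
  rw [zed, rightMul_add, add_apply, rightMul_mul, rightMul_mul, rightMul_gen, rightMul_gen]

theorem zed_commute (y : MonoidAlgebra ℝ W) : zed * y = y * zed := by
  refine groupAlgebra_induction (P := fun y => zed * y = y * zed)
    (by rw [mul_one, one_mul]) (fun a b ha hb => by rw [mul_add, add_mul, ha, hb])
    (fun c a ha => by rw [mul_smul_comm, smul_mul_assoc, ha]) (fun a i ha => ?_) y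
  rw [← mul_assoc, ha, mul_assoc, mul_assoc]
  congr 1
  have hs := of_gen_mul_self Gen.s
  have ht := of_gen_mul_self Gen.t
  unfold zed
  cases i
  · simp only [add_mul, mul_add]
    simp only [mul_assoc, hs, mul_one]
    simp only [← mul_assoc, hs, one_mul]
    rw [add_comm]
  · simp only [add_mul, mul_add]
    simp only [mul_assoc, ht, mul_one]
    simp only [← mul_assoc, ht, one_mul]
    rw [add_comm]

theorem rightGen_eq (i : Gen) (x : L2) : rightGen q i x =
    ((1 - q i) / (1 + q i)) • x + (2 / (1 + q i)) • rightT q i x := rfl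

theorem rightT_eq (hq : ∀ i, 0 < q i) (i : Gen) (x : L2) : rightT q i x =
    ((q i - 1) / 2) • x + ((q i + 1) / 2) • rightGen q i x := by
  have h : 1 + q i ≠ 0 := by have := hq i; positivity
  rw [rightGen_eq]
  match_scalars <;> field_simp <;> ring

/-- An eigenvector of `st + ts` fixed by `s` has eigenvalue `2` or `-2`. On rotations such a vector
satisfies the recurrence of `geometric_of_tendsto_zero` in both directions, so it decays
geometrically at a rate which the equation at `1` determines. -/
theorem eigenvalue_of_fixed {x : L2} {c : ℝ} (hx : x ≠ 0)
    (hs : rightGen q Gen.s x = x) (hc : rightMul q hq zed x = c • x) : c ^ 2 = 4 := by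
  have hqs := hq Gen.s
  have hqt := hq Gen.t
  obtain ⟨S, hS0, hSS⟩ : ∃ S, 0 < S ∧ S ^ 2 = q Gen.s :=
    ⟨Real.sqrt (q Gen.s), Real.sqrt_pos.mpr hqs, Real.sq_sqrt hqs.le⟩
  obtain ⟨U, hU0, hUU⟩ : ∃ U, 0 < U ∧ U ^ 2 = q Gen.t :=
    ⟨Real.sqrt (q Gen.t), Real.sqrt_pos.mpr hqt, Real.sq_sqrt hqt.le⟩
  have hSq : Real.sqrt (q Gen.s) = S := by rw [← hSS, Real.sqrt_sq hS0.le]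
  have hUq : Real.sqrt (q Gen.t) = U := by rw [← hUU, Real.sqrt_sq hU0.le]
  -- `x` is constant on cosets of `⟨s⟩` up to the factor `S = √q_s`.
  have hT : rightT q Gen.s x = q Gen.s • x := by
    rw [rightT_eq q hq, hs]
    module
  have hB : ∀ i : ℤ, S * x (refl (-i)) = if i < 0 then x (rot i) else q Gen.s * x (rot i) := by
    intro i
    have h := congrArg (fun y : L2 => y (rot i)) hT
    have h' : rightT q Gen.s x (rot i) = q Gen.s * x (rot i) := h
    rw [rightT_s_rot, hSq] at h'
    split_ifs at h' ⊢ <;> linarith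
  -- the equation `x (T_t + T_t T_s) = μ x`
  obtain ⟨μ, hμ⟩ : ∃ μ, c = 2 * (1 - q Gen.t) / (1 + q Gen.t) +
      4 / ((1 + q Gen.s) * (1 + q Gen.t)) * μ := by
    refine ⟨(c - 2 * (1 - q Gen.t) / (1 + q Gen.t)) * ((1 + q Gen.s) * (1 + q Gen.t)) / 4, ?_⟩
    field_simp
    ring
  have hu : rightT q Gen.t x + rightT q Gen.s (rightT q Gen.t x) = μ • x := by
    rw [rightMul_zed, hs, hμ] at hc
    rw [rightGen_eq q Gen.s, rightGen_eq q Gen.t, map_add, map_smul, map_smul, hT] at hc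
    have h4 : 4 / ((1 + q Gen.s) * (1 + q Gen.t)) ≠ 0 := by positivity
    refine smul_right_injective _ h4 ?_
    simp only
    have e : (4 / ((1 + q Gen.s) * (1 + q Gen.t))) • μ • x =
        (2 * (1 - q Gen.t) / (1 + q Gen.t) + 4 / ((1 + q Gen.s) * (1 + q Gen.t)) * μ) • x -
        (2 * (1 - q Gen.t) / (1 + q Gen.t)) • x := by module
    rw [e, ← hc]
    match_scalars <;> field_simp <;> ring
  have hpt : ∀ i : ℤ, rightT q Gen.t x (rot i) + rightT q Gen.s (rightT q Gen.t x) (rot i) =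
      μ * x (rot i) := fun i => congrArg (fun y : L2 => y (rot i)) hu
  simp only [rightT_s_rot, rightT_t_rot, rightT_t_refl, hSq, hUq] at hpt
  have hpos : ∀ i : ℤ, 0 < i → S * U * (x (rot (i - 1)) + x (rot (i + 1))) =
      (μ - q Gen.t + 1) * x (rot i) := fun i hi => by
    have h := hpt i
    have h2 := hB (i - 1)
    rw [if_neg (by omega), show -(i - 1) = 1 - i by ring] at h2
    rw [if_pos hi, if_neg (by omega), if_neg (by omega), show 1 - -i = i + 1 by ring] at h
    refine mul_left_cancel₀ hS0.ne' ?_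
    linear_combination S * h - U * h2 + (U * x (rot (i - 1))) * hSS
  have hneg : ∀ i : ℤ, i < 0 → S * U * (x (rot (i - 1)) + x (rot (i + 1))) =
      (μ - q Gen.t + 1) * x (rot i) := fun i hi => by
    have h := hpt i
    have h2 := hB (i - 1)
    have h3 := hB i
    rw [if_pos (by omega), show -(i - 1) = 1 - i by ring] at h2
    rw [if_pos hi] at h3
    rw [if_neg (by omega), if_pos hi, if_pos (by omega), show 1 - -i = i + 1 by ring] at h
    linear_combination h + (1 - q Gen.t) * h3 - (U * x (refl (1 - i))) * hSS.symm - S * U * h2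
  have hzero : U * x (rot (-1)) + S ^ 2 * U * x (rot 1) = S * μ * x (rot 0) := by
    have h := hpt 0
    have h2 := hB (-1)
    rw [neg_neg] at h2
    norm_num at h h2
    linear_combination S * h - U * h2
  have hSU : S * U ≠ 0 := by positivity
  obtain ⟨τ, hτ⟩ : ∃ τ, S * U * τ = μ - q Gen.t + 1 := ⟨_, mul_div_cancel₀ _ hSU⟩
  have h1 := geometric_of_tendsto_zero (τ := τ)
    (tendsto_comp_injective x (f := fun n : ℕ => rot (n : ℤ))
      (rot_injective.comp Nat.cast_injective)) (fun n => by
        have h := hpos (n + 1) (by positivity)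
        refine mul_left_cancel₀ hSU ?_
        rw [add_sub_cancel_right, ← hτ] at h
        rw [show ((n + 2 : ℕ) : ℤ) = n + 1 + 1 by push_cast; ring, Nat.cast_succ]
        linear_combination h)
  have h2 := geometric_of_tendsto_zero (τ := τ)
    (tendsto_comp_injective x (f := fun n : ℕ => rot (-(n : ℤ)))
      (rot_injective.comp (neg_injective.comp Nat.cast_injective))) (fun n => by
        have h := hneg (-(n + 1)) (by linarith)
        refine mul_left_cancel₀ hSU ?_
        rw [← hτ, show -((n : ℤ) + 1) + 1 = -n by ring,
          show -((n : ℤ) + 1) - 1 = -(n + 2 : ℕ) by push_cast; ring, ← Nat.cast_succ] at h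
        linear_combination h)
  have hx0 : x (rot 0) ≠ 0 := by
    intro h0
    apply hx
    have hr : ∀ i : ℤ, x (rot i) = 0 := fun i => by
      rcases h1 with ⟨-, h1⟩ | ⟨p, -, -, h1⟩ <;> rcases h2 with ⟨-, h2⟩ | ⟨p', -, -, h2⟩ <;>
      obtain ⟨n, rfl | rfl⟩ := i.eq_nat_or_neg
      all_goals first | exact h1 n | exact h2 n | skip
      all_goals first
        | (have := h1 n; simp only [Nat.cast_zero, h0, mul_zero] at this; exact this)
        | (have := h2 n; simp only [Nat.cast_zero, neg_zero, h0, mul_zero] at this; exact this)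
    ext w
    change x w = 0
    cases w with
    | r i => exact hr i
    | sr i =>
      have h := hB (-(show ℤ from i))
      rw [neg_neg, hr, mul_zero, ite_self] at h
      exact (mul_eq_zero.mp h).resolve_left hS0.ne'
  obtain ⟨p, hp1, hp2, hp⟩ := h1.resolve_left fun h => hx0 h.1
  obtain ⟨r, hr1, hr2, hr⟩ := h2.resolve_left fun h => hx0 h.1
  have hpr : p = r := by
    by_contra hne
    have e : (p - r) * (p + r - τ) = 0 := by linear_combination hp2 - hr2
    have e2 := (mul_eq_zero.mp e).resolve_left (sub_ne_zero.mpr hne)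
    have e3 : p * r = 1 := by linear_combination p * e2 - hp2
    have e4 : |p| * |r| < 1 := mul_lt_one_of_nonneg_of_lt_one_left (abs_nonneg _) hp1 hr1.le
    rw [← abs_mul, e3, abs_one] at e4
    exact lt_irrefl _ e4
  subst hpr
  have hx1 : x (rot 1) = p * x (rot 0) := by simpa using hp 1
  have hx2 : x (rot (-1)) = p * x (rot 0) := by simpa using hr 1
  rw [hx1, hx2] at hzero
  have hz : U * p * (1 + S ^ 2) = S * μ := by
    refine mul_right_cancel₀ hx0 ?_
    linear_combination hzero
  have hfac : (p - S * U) * (U * p + S) = 0 := by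
    linear_combination (-S * S * U) * hp2 - p * S * hτ + p * hz - p * S * hUU
  have hden : (1 + S ^ 2) * (1 + U ^ 2) ≠ 0 := by positivity
  rw [hμ, ← hSS, ← hUU]
  rcases mul_eq_zero.mp hfac with h | h
  · have hμ' : μ = U ^ 2 * (1 + S ^ 2) := by
      refine mul_left_cancel₀ hS0.ne' ?_
      rw [← hz, sub_eq_zero.mp h]
      ring
    have : 2 * (1 - U ^ 2) / (1 + U ^ 2) + 4 / ((1 + S ^ 2) * (1 + U ^ 2)) * μ = 2 := by
      rw [hμ']
      field_simp
      ring
    rw [this]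
    norm_num
  · have hμ' : μ = -(1 + S ^ 2) := by
      refine mul_left_cancel₀ hS0.ne' ?_
      rw [← hz]
      linear_combination (1 + S ^ 2) * h
    have : 2 * (1 - U ^ 2) / (1 + U ^ 2) + 4 / ((1 + S ^ 2) * (1 + U ^ 2)) * μ = -2 := by
      rw [hμ']
      field_simp
      ring
    rw [this]
    norm_num

/-- The only possible eigenvalues of `st + ts` on `L²_q W` are `2` and `-2`. -/
theorem eigenvalue_zed {x : L2} {c : ℝ} (hx : x ≠ 0)
    (hc : rightMul q hq zed x = c • x) : c ^ 2 = 4 := by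
  by_contra hne
  have hcomm : ∀ i y, rightMul q hq zed y = c • y →
      rightMul q hq zed (rightGen q i y) = c • rightGen q i y := fun i y hy => by
    rw [← rightMul_gen q hq, ← rightMul_mul, ← zed_commute, rightMul_mul, hy, map_smul]
  have key : ∀ y, rightMul q hq zed y = c • y → rightGen q Gen.s y = -y := fun y hy => by
    by_contra h
    refine hne (eigenvalue_of_fixed q hq (x := y + rightGen q Gen.s y) ?_ ?_ ?_)
    · intro h0
      exact h (eq_neg_of_add_eq_zero_right h0)
    · rw [map_add, rightGen_rightGen q hq, add_comm]
    · rw [map_add, hy, hcomm _ _ hy, smul_add]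
  have h1 := key x hc
  have h2 := key _ (hcomm Gen.t x hc)
  have h3 : (-2 : ℝ) • rightGen q Gen.t x = c • x := by
    rw [← hc, rightMul_zed, h1, h2, map_neg]
    module
  have h4 := congrArg (rightGen q Gen.t) h3
  rw [map_smul, map_smul, rightGen_rightGen q hq] at h4
  have h5 : (c ^ 2 - 4) • x = 0 := by
    have : (c ^ 2 - 4) • x = c • (c • x) - (4 : ℝ) • x := by module
    rw [this, ← h3, smul_comm c, ← h4]
    module
  exact (smul_eq_zero.mp h5).elim (fun h => hne (by linarith)) hx

/-- If `f(A) x = 0` for a symmetric operator `A` and `f ≠ 0`, then `x` is a sum of eigenvectors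
of `A`; hence `g(A) x = 0` as soon as `g(A)` kills every eigenvector. -/
theorem aeval_apply_eq_zero_of_symmetric {E : Type*} [NormedAddCommGroup E] [InnerProductSpace ℝ E]
    {A : E →ₗ[ℝ] E} (hA : A.IsSymmetric) {f g : Polynomial ℝ} (hf : f ≠ 0)
    (hg : ∀ (c : ℝ) (v : E), A v = c • v → Polynomial.aeval A g v = 0) {x : E}
    (hx : Polynomial.aeval A f x = 0) : Polynomial.aeval A g x = 0 := by
  let φ : Polynomial ℝ →ₗ[ℝ] E :=
    (LinearMap.applyₗ x).comp (Polynomial.aeval A).toLinearMap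
  have hφ : ∀ p, φ p = Polynomial.aeval A p x := fun _ => rfl
  let S : Submodule ℝ E := (Polynomial.degreeLT ℝ f.natDegree).map φ
  have hfin : FiniteDimensional ℝ (Polynomial.degreeLT ℝ f.natDegree) :=
    Module.Finite.equiv (Polynomial.degreeLTEquiv ℝ f.natDegree).symm
  have hS : FiniteDimensional ℝ S := inferInstance
  have hmem : ∀ p, φ p ∈ S := fun p => by
    refine ⟨p % f, ?_, ?_⟩
    · rw [SetLike.mem_coe, Polynomial.mem_degreeLT, ← Polynomial.degree_eq_natDegree hf]
      exact Polynomial.degree_mod_lt p hf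
    · rw [hφ, hφ]
      conv_rhs => rw [← EuclideanDomain.mod_add_div p f]
      rw [map_add, LinearMap.add_apply, mul_comm f, map_mul, Module.End.mul_apply, hx, map_zero,
        add_zero]
  have hinv : ∀ v ∈ S, A v ∈ S := by
    rintro _ ⟨p, -, rfl⟩
    have : A (φ p) = φ (Polynomial.X * p) := by
      rw [hφ, hφ, map_mul, Polynomial.aeval_X, Module.End.mul_apply]
    rw [this]
    exact hmem _
  have hsym := hA.restrict_invariant hinv
  have hxS : x ∈ S := by
    have := hmem 1
    rwa [hφ, map_one, Module.End.one_apply] at this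
  have hsum := congrArg Subtype.val ((hsym.eigenvectorBasis rfl).sum_repr ⟨x, hxS⟩)
  change _ = x at hsum
  rw [← hsum, AddSubmonoidClass.coe_finsetSum, map_sum]
  refine Finset.sum_eq_zero fun i _ => ?_
  have h := hg (hsym.eigenvalues rfl i) (hsym.eigenvectorBasis rfl i : S)
    (congrArg Subtype.val (hsym.apply_eigenvectorBasis rfl i))
  rw [Submodule.coe_smul, map_smul, h, smul_zero]

end Spectral

/-! ### One-dimensional invariant subspaces -/

section Characters

open Filter Topology

variable (q : Gen → ℝ) (hq : ∀ i, 0 < q i)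

/-- The Poincaré series of `W`: the sum of `q^w` over `w ∈ W`. -/
theorem hasSum_qpow {p : Gen → ℝ} (hp : ∀ i, 0 ≤ p i) (h : p Gen.s * p Gen.t < 1) :
    HasSum (qpow p)
      ((1 + p Gen.s) * (1 + p Gen.t) / (1 - p Gen.s * p Gen.t)) := by
  have hgeom := hasSum_geometric_of_lt_one (mul_nonneg (hp Gen.s) (hp Gen.t)) h
  set a := p Gen.s
  set b := p Gen.t
  have hr : HasSum (fun i : ℤ => (a * b) ^ Int.natAbs i) ((1 - a * b)⁻¹ + a * b * (1 - a * b)⁻¹) :=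
    HasSum.of_nat_of_neg_add_one (by simpa using hgeom) (by
      refine (hgeom.mul_left (a * b)).congr_fun fun n => ?_
      rw [show (-((n : ℤ) + 1)).natAbs = n + 1 by omega, pow_succ'])
  have hs : HasSum (fun i : ℤ => if i ≤ 0 then a ^ (Int.natAbs i + 1) * b ^ Int.natAbs i
      else a ^ (Int.natAbs i - 1) * b ^ Int.natAbs i) (b * (1 - a * b)⁻¹ + a * (1 - a * b)⁻¹) := by
    rw [← (Equiv.addRight (1 : ℤ)).hasSum_iff]
    refine HasSum.of_nat_of_neg_add_one ?_ ?_
    · refine (hgeom.mul_left b).congr_fun fun n => ?_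
      change (if (n : ℤ) + 1 ≤ 0 then a ^ (Int.natAbs ((n : ℤ) + 1) + 1) *
        b ^ Int.natAbs ((n : ℤ) + 1) else a ^ (Int.natAbs ((n : ℤ) + 1) - 1) *
        b ^ Int.natAbs ((n : ℤ) + 1)) = _
      rw [if_neg (by omega), show ((n : ℤ) + 1).natAbs = n + 1 by omega, Nat.add_sub_cancel]
      ring
    · refine (hgeom.mul_left a).congr_fun fun n => ?_
      change (if -((n : ℤ) + 1) + 1 ≤ 0 then a ^ (Int.natAbs (-((n : ℤ) + 1) + 1) + 1) *
        b ^ Int.natAbs (-((n : ℤ) + 1) + 1) else a ^ (Int.natAbs (-((n : ℤ) + 1) + 1) - 1) *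
        b ^ Int.natAbs (-((n : ℤ) + 1) + 1)) = _
      rw [if_pos (by omega), show (-((n : ℤ) + 1) + 1).natAbs = n by omega]
      ring
  let e : ℤ ⊕ ℤ ≃ W :=
    { toFun := Sum.elim rot refl
      invFun := fun w => match w with
        | DihedralGroup.r i => Sum.inl i
        | DihedralGroup.sr i => Sum.inr i
      left_inv := by rintro (i | i) <;> rfl
      right_inv := by rintro (i | i) <;> rfl }
  rw [← e.hasSum_iff]
  have h1 : 1 - a * b ≠ 0 := by linarith
  have hsum := HasSum.sum (f := qpow p ∘ e) hr hs
  convert! hsum using 1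
  field_simp
  ring

/-- The factor by which a vector `x` with `x · i = σ x` changes along a lengthening edge `w, w i`
(in the orthonormal coordinates of `L2`): `√q` for `σ = 1` and `-1/√q` for `σ = -1`. -/
def ratio (σ : Gen → ℝ) (i : Gen) : ℝ :=
  ((q i - 1) / 2 + (q i + 1) / 2 * σ i) / Real.sqrt (q i)

theorem apply_eq_qpow (hq : ∀ i, 0 < q i) {σ : Gen → ℝ} {x : L2}
    (hx : ∀ i, rightGen q i x = σ i • x) (w : W) : x w = qpow (ratio q σ) w * x 1 := by
  classical
  obtain ⟨n, hn⟩ : ∃ n, len w = n := ⟨_, rfl⟩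
  induction n generalizing w with
  | zero => rw [eq_one_of_len_eq_zero w hn, qpow_one, one_mul]
  | succ n ih =>
    obtain ⟨i, hi⟩ := exists_len_mul_gen w (by omega)
    have hlt : wordLength (w * gen i) < wordLength (w * gen i * gen i) := by
      rw [mul_gen_mul_gen, wordLength_eq, wordLength_eq]
      omega
    have h1 := qpow_mul_gen (ratio q σ) (w * gen i) i hlt
    rw [mul_gen_mul_gen] at h1 hlt
    have h2 : rightT q i x (w * gen i) = ((q i - 1) / 2 + (q i + 1) / 2 * σ i) * x (w * gen i) := by
      rw [rightT_eq q hq, hx, smul_smul, ← add_smul]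
      rfl
    rw [rightT_apply, mul_gen_mul_gen, if_neg hlt.le.not_gt, mul_zero, add_zero] at h2
    have h3 : Real.sqrt (q i) ≠ 0 := (Real.sqrt_pos.mpr (hq i)).ne'
    rw [h1, mul_right_comm, ← ih (w * gen i) (by omega)]
    unfold ratio
    rw [← mul_div_assoc, eq_div_iff h3, mul_comm, h2, mul_comm]

theorem qpow_sq (p : Gen → ℝ) (w : W) : qpow p w ^ 2 = qpow (fun i => p i ^ 2) w := by
  cases w with
  | r j =>
    unfold qpow
    simp only
    ring
  | sr j =>
    unfold qpow
    simp only
    split_ifs <;> ring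

theorem ratio_sq (hq : ∀ i, 0 < q i) {σ : Gen → ℝ} {i : Gen} (hσ : σ i = 1 ∨ σ i = -1) :
    (σ i = 1 ∧ ratio q σ i ^ 2 = q i) ∨ (σ i = -1 ∧ ratio q σ i ^ 2 = (q i)⁻¹) := by
  have h := hq i
  rcases hσ with h1 | h1
  · left
    refine ⟨h1, ?_⟩
    unfold ratio
    rw [h1, div_pow, Real.sq_sqrt h.le]
    field_simp
    ring
  · right
    refine ⟨h1, ?_⟩
    unfold ratio
    rw [h1, div_pow, Real.sq_sqrt h.le]
    field_simp
    ring

theorem one_div_add_mem_Lambda (i : Gen) : 1 / (1 + q i) ∈ Lambda q := by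
  cases i
  · exact AddSubgroup.subset_closure (by simp)
  · exact AddSubgroup.subset_closure (by simp)

theorem one_mem_Lambda : (1 : ℝ) ∈ Lambda q := AddSubgroup.subset_closure (by simp)

theorem norm_sq_eq_tsum (x : L2) : HasSum (fun w => x w ^ 2) (‖x‖ ^ 2) := by
  have h := lp.hasSum_inner (𝕜 := ℝ) x x
  rw [real_inner_self_eq_norm_sq] at h
  refine h.congr_fun fun w => ?_
  change x w ^ 2 = x w * x w
  ring

/-- A joint eigenvector of `s` and `t` with eigenvalues `σ` is determined by its value at `1`, and
is square-summable only if the Poincaré series at the parameters `ratio²` converges. -/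
theorem joint_eigenvector (hq : ∀ i, 0 < q i) {σ : Gen → ℝ} {x : L2}
    (hx : ∀ i, rightGen q i x = σ i • x) (hx0 : x ≠ 0) :
    x 1 ≠ 0 ∧ ratio q σ Gen.s ^ 2 * ratio q σ Gen.t ^ 2 < 1 := by
  have hval := apply_eq_qpow q hq hx
  have h1 : x 1 ≠ 0 := by
    intro h
    apply hx0
    ext w
    rw [hval, h, mul_zero]
    rfl
  refine ⟨h1, ?_⟩
  have h2 := tendsto_comp_injective x (f := fun n : ℕ => rot (n : ℤ))
      (rot_injective.comp Nat.cast_injective)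
  have h3 := h2.mul_const (x 1)⁻¹
  rw [zero_mul] at h3
  have h4 : Tendsto (fun n : ℕ => (ratio q σ Gen.s * ratio q σ Gen.t) ^ n) atTop (𝓝 0) := by
    refine h3.congr fun n => ?_
    rw [hval, mul_inv_cancel_right₀ h1]
    rfl
  have h5 := tendsto_pow_atTop_nhds_zero_iff.mp h4
  rw [← mul_pow, ← sq_abs]
  exact pow_lt_one₀ (abs_nonneg _) h5 two_ne_zero

theorem joint_eigenvector_mem_Lambda (hq : ∀ i, 0 < q i) {σ : Gen → ℝ}
    (hσ : ∀ i, σ i = 1 ∨ σ i = -1) {x : L2}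
    (hx : ∀ i, rightGen q i x = σ i • x) (hx1 : ‖x‖ = 1) : x 1 ^ 2 ∈ Lambda q := by
  have hx0 : x ≠ 0 := by
    intro h
    rw [h, norm_zero] at hx1
    exact zero_ne_one hx1
  obtain ⟨h1, h2⟩ := joint_eigenvector q hq hx hx0
  have hsum := hasSum_qpow (p := fun i => ratio q σ i ^ 2) (fun i => sq_nonneg _) h2
  have hnorm := norm_sq_eq_tsum x
  have h3 := hnorm.unique ((hsum.mul_right (x 1 ^ 2)).congr_fun fun w => by
    rw [apply_eq_qpow q hq hx, mul_pow, qpow_sq])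
  rw [hx1] at h3
  have hmem : ∀ i, 1 / (1 + ratio q σ i ^ 2) ∈ Lambda q := fun i => by
    rcases ratio_sq q hq (hσ i) with ⟨-, e⟩ | ⟨-, e⟩
    · rw [e]
      exact one_div_add_mem_Lambda q i
    · rw [e]
      have h4 := hq i
      have : 1 / (1 + (q i)⁻¹) = 1 - 1 / (1 + q i) := by
        field_simp
        ring
      rw [this]
      exact sub_mem (one_mem_Lambda q) (one_div_add_mem_Lambda q i)
  have hfin : x 1 ^ 2 = 1 / (1 + ratio q σ Gen.s ^ 2) + 1 / (1 + ratio q σ Gen.t ^ 2) - 1 := by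
    simp only at h3 h2
    have ha := sq_nonneg (ratio q σ Gen.s)
    have hb := sq_nonneg (ratio q σ Gen.t)
    generalize ratio q σ Gen.s ^ 2 = a at *
    generalize ratio q σ Gen.t ^ 2 = b at *
    have hab : 1 - a * b ≠ 0 := by linarith
    have ha' : 1 + a ≠ 0 := by linarith
    have hb' : 1 + b ≠ 0 := by linarith
    field_simp at h3 ⊢
    linear_combination -h3
  rw [hfin]
  exact sub_mem (add_mem (hmem _) (hmem _)) (one_mem_Lambda q)

theorem inner_T_one (x : L2) : ⟪T q 1, x⟫_ℝ = x 1 := by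
  classical
  have h : ⟪T q 1, x⟫_ℝ = ⟪Real.sqrt (qpow q 1), x 1⟫_ℝ := lp.inner_single_left _ _ _
  rw [h, qpow_one, Real.sqrt_one]
  simp

/-- A central element `c` of `ℝW` is *thin* if its kernel on `L²_q W` is zero or a line spanned by
a unit joint eigenvector of `ℝW` whose coefficient at `T_1` has its square in `Λ_q`. -/
def Thin (c : MonoidAlgebra ℝ W) : Prop :=
  (∀ x, rightMul q hq c x = 0 → x = 0) ∨
    ∃ v : L2, ‖v‖ = 1 ∧ (∀ y, ∃ a : ℝ, rightMul q hq y v = a • v) ∧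
      rightMul q hq c v = 0 ∧ (∀ x, rightMul q hq c x = 0 → ∃ a : ℝ, x = a • v) ∧
      v 1 ^ 2 ∈ Lambda q

/-- `st + ts - 2ε` is `-(s - εt)²` for `ε = ±1`, so its kernel is that of `s - εt`. -/
theorem rightGen_eq_of_zed {ε : ℝ} (hε : ε = 1 ∨ ε = -1) {x : L2}
    (hx : rightMul q hq (zed - (2 * ε) • 1) x = 0) :
    rightGen q Gen.t x = ε • rightGen q Gen.s x := by
  have hε2 : ε * ε = 1 := by rcases hε with rfl | rfl <;> norm_num
  rw [rightMul_sub, rightMul_smul, rightMul_one, sub_apply, smul_apply, rightMul_zed] at hx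
  change _ - (2 * ε) • x = 0 at hx
  rw [← sub_eq_zero, ← inner_self_eq_zero (𝕜 := ℝ)]
  have e := congrArg (fun y => ⟪x, y⟫_ℝ) hx
  simp only [inner_sub_right, inner_add_right, inner_zero_right, real_inner_smul_right] at e
  simp only [inner_sub_left, inner_sub_right, real_inner_smul_left, real_inner_smul_right,
    inner_rightGen, rightGen_rightGen q hq]
  linear_combination -ε * e - ⟪x, x⟫_ℝ * hε2

theorem thin_zed_sub {ε : ℝ} (hε : ε = 1 ∨ ε = -1) : Thin q hq (zed - (2 * ε) • 1) := by
  have hε2 : ε * ε = 1 := by rcases hε with rfl | rfl <;> norm_num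
  by_cases hker : ∀ x, rightMul q hq (zed - (2 * ε) • 1) x = 0 → x = 0
  · exact Or.inl hker
  right
  push Not at hker
  obtain ⟨x₀, hx₀, hne⟩ := hker
  let σ : ℝ → Gen → ℝ := fun η i => match i with
    | Gen.s => η
    | Gen.t => ε * η
  -- the components of a vector of the kernel in the two joint eigenspaces
  have hcomp : ∀ (η : ℝ), η * η = 1 → ∀ x, rightMul q hq (zed - (2 * ε) • 1) x = 0 →
      ∀ i, rightGen q i (x + η • rightGen q Gen.s x) = σ η i • (x + η • rightGen q Gen.s x) := by
    intro η hη x hx i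
    have ht := rightGen_eq_of_zed q hq hε hx
    cases i
    · change _ = η • _
      rw [map_add, map_smul, rightGen_rightGen q hq, smul_add, smul_smul, hη, one_smul, add_comm]
    · change _ = (ε * η) • _
      have hts : rightGen q Gen.t (rightGen q Gen.s x) = ε • x := by
        have h := congrArg (rightGen q Gen.t) ht
        rw [rightGen_rightGen q hq, map_smul] at h
        conv_rhs => rw [h]
        rw [smul_smul, hε2, one_smul]
      rw [map_add, map_smul, ht, hts]
      match_scalars
      · linear_combination ε * hη.symm
      · ring
  have hη : ∃ η : ℝ, (η = 1 ∨ η = -1) ∧ x₀ + η • rightGen q Gen.s x₀ ≠ 0 := by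
    by_contra hcon
    push Not at hcon
    apply hne
    have h1 := hcon 1 (Or.inl rfl)
    have h2 := hcon (-1) (Or.inr rfl)
    have : (2 : ℝ) • x₀ = (x₀ + (1 : ℝ) • rightGen q Gen.s x₀) +
      (x₀ + (-1 : ℝ) • rightGen q Gen.s x₀) := by module
    rw [h1, h2, add_zero] at this
    exact (smul_eq_zero.mp this).resolve_left two_ne_zero
  obtain ⟨η, hη, hu0⟩ := hη
  have hη2 : η * η = 1 := by rcases hη with rfl | rfl <;> norm_num
  have hσ : ∀ i, σ η i = 1 ∨ σ η i = -1 := fun i => by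
    cases i
    · exact hη
    · change ε * η = 1 ∨ ε * η = -1
      rcases hε with rfl | rfl <;> rcases hη with rfl | rfl <;> norm_num
  have hσ' : ∀ i, σ (-η) i = -σ η i := fun i => by
    cases i
    · rfl
    · exact mul_neg ε η
  have hu := hcomp η hη2 x₀ hx₀
  set u := x₀ + η • rightGen q Gen.s x₀
  -- At most one of the two joint eigenspaces is nonzero, as their Poincaré series have inverse
  -- parameters.
  have hjoint : ∀ x, rightMul q hq (zed - (2 * ε) • 1) x = 0 →
      ∀ i, rightGen q i x = σ η i • x := by
    intro x hx
    have h0 : x + (-η) • rightGen q Gen.s x = 0 := by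
      by_contra h
      have h1 := (joint_eigenvector q hq (hcomp (-η) (by linarith) x hx) h).2
      have h2 := (joint_eigenvector q hq hu hu0).2
      have h3 : ∀ i, ratio q (σ η) i ^ 2 * ratio q (σ (-η)) i ^ 2 = 1 := fun i => by
        have hi := (hq i).ne'
        have hne1 : (1 : ℝ) ≠ -1 := by norm_num
        rcases ratio_sq q hq (hσ i) with ⟨e1, e2⟩ | ⟨e1, e2⟩ <;>
        rcases ratio_sq q hq (σ := σ (-η)) (i := i)
          (by rw [hσ', neg_inj, neg_eq_iff_eq_neg]; exact (hσ i).symm) with ⟨e3, e4⟩ | ⟨e3, e4⟩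
        · rw [hσ', e1] at e3; exact absurd e3.symm hne1
        · rw [e2, e4, mul_inv_cancel₀ hi]
        · rw [e2, e4, inv_mul_cancel₀ hi]
        · rw [hσ', e1, neg_neg] at e3; exact absurd e3 hne1
      have h4 : (ratio q (σ η) Gen.s ^ 2 * ratio q (σ η) Gen.t ^ 2) *
          (ratio q (σ (-η)) Gen.s ^ 2 * ratio q (σ (-η)) Gen.t ^ 2) = 1 := by
        rw [mul_mul_mul_comm, h3, h3, one_mul]
      have h5 := mul_lt_one_of_nonneg_of_lt_one_left (by positivity) h2 h1.le
      rw [h4] at h5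
      exact lt_irrefl _ h5
    have h6 : x = (1 / 2 : ℝ) • (x + η • rightGen q Gen.s x) := by
      have : x = (1 / 2 : ℝ) • (x + η • rightGen q Gen.s x) +
        (1 / 2 : ℝ) • (x + (-η) • rightGen q Gen.s x) := by module
      rwa [h0, smul_zero, add_zero] at this
    intro i
    rw [h6, map_smul, hcomp η hη2 x hx i, smul_comm]
  have hv : ∀ i, rightGen q i (‖u‖⁻¹ • u) = σ η i • ‖u‖⁻¹ • u := fun i => by
    rw [map_smul, hu, smul_comm]
  have hv1 : ‖‖u‖⁻¹ • u‖ = 1 := norm_smul_inv_norm (𝕜 := ℝ) hu0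
  generalize ‖u‖⁻¹ • u = v at hv hv1
  have hv0 : v ≠ 0 := fun h => by
    rw [h, norm_zero] at hv1
    exact zero_ne_one hv1
  refine ⟨v, hv1, ?_, ?_, ?_, joint_eigenvector_mem_Lambda q hq hσ hv hv1⟩
  · refine fun y => groupAlgebra_induction (P := fun y => ∃ a : ℝ, rightMul q hq y v = a • v)
      ⟨1, by rw [rightMul_one, one_smul]; rfl⟩ ?_ ?_ ?_ y
    · rintro x y ⟨a, ha⟩ ⟨b, hb⟩
      exact ⟨a + b, by rw [rightMul_add, add_apply, ha, hb, add_smul]⟩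
    · rintro c x ⟨a, ha⟩
      exact ⟨c * a, by rw [rightMul_smul, smul_apply, ha, smul_smul]⟩
    · rintro x i ⟨a, ha⟩
      exact ⟨a * σ η i, by rw [rightMul_mul, ha, map_smul, rightMul_gen, hv, smul_smul]⟩
  · rw [rightMul_sub, rightMul_smul, rightMul_one, sub_apply, smul_apply, rightMul_zed, hv, hv,
      map_smul, map_smul, hv, hv]
    change η • (ε * η) • v + (ε * η) • η • v - (2 * ε) • v = 0
    match_scalars
    linear_combination 2 * ε * hη2
  · intro x hx
    refine ⟨x 1 / v 1, ?_⟩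
    ext w
    change x w = x 1 / v 1 * v w
    have hv1' := (joint_eigenvector q hq hv hv0).1
    rw [apply_eq_qpow q hq (hjoint x hx) w, apply_eq_qpow q hq hv w]
    field_simp

end Characters

/-! ### Kernels of central multiples of a matrix -/

section Splitting

variable (q : Gen → ℝ) (hq : ∀ i, 0 < q i)

theorem rightMulMatrix_central_smul {c : MonoidAlgebra ℝ W} (hc : ∀ y, c * y = y * c) {m n : ℕ}
    (M : Matrix (Fin m) (Fin n) (MonoidAlgebra ℝ W)) (x : L2Pow m) (j : Fin n) :
    rightMulMatrix q hq (c • M) x j = rightMul q hq c (rightMulMatrix q hq M x j) := by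
  simp only [rightMulMatrix_apply, Matrix.smul_apply, smul_eq_mul, hc, rightMul_mul, map_sum]

theorem mem_kerRightMul_central_smul {c : MonoidAlgebra ℝ W} (hc : ∀ y, c * y = y * c) {m n : ℕ}
    (M : Matrix (Fin m) (Fin n) (MonoidAlgebra ℝ W)) (x : L2Pow m) :
    x ∈ kerRightMul q hq (c • M) ↔
      ∀ j, rightMul q hq c (rightMulMatrix q hq M x j) = 0 := by
  rw [mem_kerRightMul]
  constructor
  · intro h j
    rw [← rightMulMatrix_central_smul q hq hc, h]
    rfl
  · intro h
    ext1 j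
    rw [rightMulMatrix_central_smul q hq hc, h]
    rfl

/-- The trace of the orthogonal projection onto a subspace of `ℝ^m` is its dimension. -/
theorem sum_inner_starProjection_single {m : ℕ} (K : Submodule ℝ (EuclideanSpace ℝ (Fin m))) :
    ∑ i, ⟪K.starProjection (EuclideanSpace.single i 1), EuclideanSpace.single i (1 : ℝ)⟫_ℝ =
      Module.finrank ℝ K := by
  have h : LinearMap.IsProj K K.starProjection.toLinearMap :=
    ⟨fun x => K.starProjection_apply_mem x, fun x hx => Submodule.starProjection_eq_self_iff.mpr hx⟩
  rw [← h.trace, LinearMap.trace_eq_sum_inner _ (EuclideanSpace.basisFun (Fin m) ℝ)]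
  refine Finset.sum_congr rfl fun i _ => ?_
  rw [EuclideanSpace.basisFun_apply, real_inner_comm]
  rfl

/-- Multiplying a matrix `M` by a thin central element `c` changes the dimension of the kernel by
an element of `Λ_q`. If `ker c = ℝ v` and `v y = χ(y) v` for `y ∈ ℝW`, then `ker R_{cM}` is the
orthogonal sum of `ker R_M` and `(ker χ(M))ᗮ ⊗ v`. -/
theorem heckeDim_smul_sub_mem_Lambda {c : MonoidAlgebra ℝ W} (hc : ∀ y, c * y = y * c)
    (hthin : Thin q hq c) {m n : ℕ} (M : Matrix (Fin m) (Fin n) (MonoidAlgebra ℝ W)) :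
    heckeDim q (kerRightMul q hq (c • M)) - heckeDim q (kerRightMul q hq M) ∈ Lambda q := by
  have hmem := mem_kerRightMul_central_smul q hq hc M
  have hle : kerRightMul q hq M ≤ kerRightMul q hq (c • M) := fun x hx => by
    rw [hmem]
    intro j
    rw [mem_kerRightMul] at hx
    rw [hx]
    exact map_zero _
  rcases hthin with hinj | ⟨v, hv1, hv, hcv, hker, hvL⟩
  · have e : kerRightMul q hq (c • M) = kerRightMul q hq M := by
      refine le_antisymm (fun x hx => ?_) hle
      rw [hmem] at hx
      rw [mem_kerRightMul]
      ext1 j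
      exact hinj _ (hx j)
    rw [heckeDim_congr q e, sub_self]
    exact zero_mem _
  have hvv : ⟪v, v⟫_ℝ = 1 := by rw [real_inner_self_eq_norm_sq, hv1, one_pow]
  choose χ hχ using hv
  have hχ' : ∀ y, χ (invol y) = χ y := fun y => by
    have h := inner_rightMul q hq y v v
    rw [hχ, hχ, real_inner_smul_left, real_inner_smul_right, hvv, mul_one, mul_one] at h
    exact h.symm
  let K : Submodule ℝ (EuclideanSpace ℝ (Fin m)) :=
    { carrier := {u | ∀ j, ∑ i, χ (M i j) * u i = 0}
      zero_mem' := fun j => by simp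
      add_mem' := fun {a b} ha hb j => by
        simp only [PiLp.add_apply, mul_add, Finset.sum_add_distrib]
        rw [ha j, hb j, add_zero]
      smul_mem' := fun r a ha j => by
        simp only [PiLp.smul_apply, smul_eq_mul, mul_left_comm _ r, ← Finset.mul_sum]
        rw [ha j, mul_zero] }
  have hK : ∀ u, u ∈ K ↔ ∀ j, ∑ i, χ (M i j) * u i = 0 := fun _ => Iff.rfl
  let P : EuclideanSpace ℝ (Fin m) → EuclideanSpace ℝ (Fin m) := fun u => u - K.starProjection u
  have hP : ∀ u, ∀ w ∈ K, ⟪P u, w⟫_ℝ = 0 := fun u w hw => K.starProjection_inner_eq_zero u w hw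
  let π : L2Pow m → EuclideanSpace ℝ (Fin m) := fun x => WithLp.toLp 2 fun i => ⟪x i, v⟫_ℝ
  let ι : EuclideanSpace ℝ (Fin m) → L2Pow m := fun u => WithLp.toLp 2 fun i => u i • v
  have hπ : ∀ x i, π x i = ⟪x i, v⟫_ℝ := fun _ _ => rfl
  have hι : ∀ u i, ι u i = u i • v := fun _ _ => rfl
  have hπι : ∀ x u, ⟪x, ι u⟫_ℝ = ⟪π x, u⟫_ℝ := fun x u => by
    rw [PiLp.inner_apply, PiLp.inner_apply]
    refine Finset.sum_congr rfl fun i _ => ?_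
    rw [hι, real_inner_smul_right, hπ]
    change _ = u i * _
    rfl
  have hRι : ∀ u j, rightMulMatrix q hq M (ι u) j = (∑ i, χ (M i j) * u i) • v := fun u j => by
    rw [rightMulMatrix_apply, Finset.sum_smul]
    refine Finset.sum_congr rfl fun i _ => ?_
    rw [hι, map_smul, hχ, smul_smul, mul_comm]
  have hπR : ∀ x j, ⟪rightMulMatrix q hq M x j, v⟫_ℝ = ∑ i, χ (M i j) * π x i := fun x j => by
    rw [rightMulMatrix_apply, sum_inner]
    refine Finset.sum_congr rfl fun i _ => ?_
    rw [inner_rightMul, hχ, hχ', real_inner_smul_right, hπ]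
  have hπker : ∀ x ∈ kerRightMul q hq M, π x ∈ K := fun x hx j => by
    rw [mem_kerRightMul] at hx
    rw [← hπR, hx]
    exact inner_zero_left _
  have hπι' : ∀ u, π (ι u) = u := fun u => by
    ext i
    rw [hπ, hι, real_inner_smul_left, hvv, mul_one]
  have hιmem : ∀ u, ι u ∈ kerRightMul q hq (c • M) := fun u => by
    rw [hmem]
    intro j
    rw [hRι, map_smul, hcv, smul_zero]
  -- the component of a vector of `ker R_{cM}` in `ker R_M`
  have hcomp : ∀ x ∈ kerRightMul q hq (c • M), x - ι (P (π x)) ∈ kerRightMul q hq M := by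
    intro x hx
    rw [hmem] at hx
    rw [mem_kerRightMul, map_sub]
    ext1 j
    rw [PiLp.sub_apply, hRι]
    obtain ⟨a, ha⟩ := hker _ (hx j)
    have ha' : a = ∑ i, χ (M i j) * π x i := by
      rw [← hπR, ha, real_inner_smul_left, hvv, mul_one]
    have h0 := (hK _).mp (K.starProjection_apply_mem (π x)) j
    have hsum : ∑ i, χ (M i j) * P (π x) i = a := by
      rw [ha', ← sub_eq_zero, ← Finset.sum_sub_distrib, ← neg_eq_zero, ← Finset.sum_neg_distrib,
        ← h0]
      refine Finset.sum_congr rfl fun i _ => ?_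
      change -(χ (M i j) * (π x i - K.starProjection (π x) i) - _) = _
      ring
    rw [hsum, ha, sub_self]
    rfl
  set V := kerRightMul q hq M
  have hproj : ∀ x, (kerRightMul q hq (c • M)).starProjection x =
      V.starProjection x + ι (P (π x)) := fun x => by
    refine Submodule.eq_starProjection_of_mem_of_inner_eq_zero
      (add_mem (hle (V.starProjection_apply_mem x)) (hιmem _)) fun w hw => ?_
    obtain ⟨w0, z, hw0, hz, rfl⟩ : ∃ w0 z, w0 ∈ V ∧ (∀ k ∈ K, ⟪k, z⟫_ℝ = 0) ∧ w = w0 + ι z :=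
      ⟨_, P (π w), hcomp w hw, fun k hk => by rw [real_inner_comm, hP _ _ hk],
        (sub_add_cancel _ _).symm⟩
    have h1 := V.starProjection_inner_eq_zero x w0 hw0
    have h2 : ⟪ι (P (π x)), w0⟫_ℝ = 0 := by
      rw [real_inner_comm, hπι, real_inner_comm, hP _ _ (hπker _ hw0)]
    have h3 : ⟪V.starProjection x, ι z⟫_ℝ = 0 := by
      rw [hπι, hz _ (hπker _ (V.starProjection_apply_mem x))]
    have h4 : ⟪ι (P (π x)), ι z⟫_ℝ = ⟪π x, z⟫_ℝ := by
      rw [hπι, hπι']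
      change ⟪π x - K.starProjection (π x), z⟫_ℝ = _
      rw [inner_sub_left, hz _ (K.starProjection_apply_mem _), sub_zero]
    have h5 := hπι x z
    rw [inner_sub_left] at h1 ⊢
    simp only [inner_add_left, inner_add_right]
    linear_combination h1 - h2 - h3 - h4 + h5
  have htrace : ∀ i, ⟪(kerRightMul q hq (c • M)).starProjection (stdBasis q i), stdBasis q i⟫_ℝ =
      ⟪V.starProjection (stdBasis q i), stdBasis q i⟫_ℝ +
        v 1 ^ 2 * (1 - ⟪K.starProjection (EuclideanSpace.single i 1),
          EuclideanSpace.single i (1 : ℝ)⟫_ℝ) := fun i => by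
    have e : π (stdBasis q i) = v 1 • EuclideanSpace.single i (1 : ℝ) := by
      ext j
      rw [hπ, stdBasis_apply, PiLp.smul_apply, PiLp.single_apply]
      split_ifs
      · rw [inner_T_one, smul_eq_mul, mul_one]
      · rw [inner_zero_left, smul_zero]
    rw [hproj, inner_add_left, real_inner_comm _ (ι _), hπι, e]
    change _ + ⟪v 1 • _, v 1 • _ - K.starProjection (v 1 • _)⟫_ℝ = _
    rw [map_smul, ← smul_sub, real_inner_smul_left, real_inner_smul_right, inner_sub_right,
      real_inner_self_eq_norm_sq, PiLp.norm_single, norm_one,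
      real_inner_comm (K.starProjection _)]
    ring
  have hdim : heckeDim q (kerRightMul q hq (c • M)) - heckeDim q V =
      ((m : ℤ) - Module.finrank ℝ K : ℤ) • v 1 ^ 2 := by
    unfold heckeDim
    simp only [htrace]
    rw [Finset.sum_add_distrib, ← Finset.mul_sum, Finset.sum_sub_distrib,
      sum_inner_starProjection_single, Finset.sum_const, Finset.card_univ, Fintype.card_fin,
      zsmul_eq_mul]
    push_cast
    ring
  rw [hdim]
  exact zsmul_mem hvL _

end Splitting

/-! ### Rank factorization over a domain -/

section RankFactorization

theorem exists_rank_factorization {K : Type*} [Field K] {a b : ℕ} (A : Matrix (Fin a) (Fin b) K) :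
    ∃ (r : ℕ) (B : Matrix (Fin a) (Fin r) K) (C : Matrix (Fin r) (Fin b) K)
      (L : Matrix (Fin r) (Fin a) K) (R : Matrix (Fin b) (Fin r) K),
      A = B * C ∧ L * A * R = 1 := by
  let f := Matrix.toLin' A
  let e := (Module.finBasis K f.range).equivFun
  let i := f.range.subtype ∘ₗ e.symm.toLinearMap
  let p := e.toLinearMap ∘ₗ f.rangeRestrict
  have hi : LinearMap.ker i = ⊥ := LinearMap.ker_eq_bot.mpr
    (Subtype.val_injective.comp e.symm.injective)
  have hp : LinearMap.range p = ⊤ := LinearMap.range_eq_top.mpr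
    (e.surjective.comp f.surjective_rangeRestrict)
  obtain ⟨l, hl⟩ := i.exists_leftInverse_of_injective hi
  obtain ⟨s, hs⟩ := p.exists_rightInverse_of_surjective hp
  have hf : f = i ∘ₗ p := by
    refine LinearMap.ext fun x => ?_
    change f x = f.range.subtype (e.symm (e (f.rangeRestrict x)))
    rw [e.symm_apply_apply]
    rfl
  refine ⟨_, LinearMap.toMatrix' i, LinearMap.toMatrix' p, LinearMap.toMatrix' l,
    LinearMap.toMatrix' s, ?_, ?_⟩
  · rw [← LinearMap.toMatrix'_comp, ← hf, LinearMap.toMatrix'_toLin']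
  · rw [← LinearMap.toMatrix'_toLin' A, ← LinearMap.toMatrix'_comp, ← LinearMap.toMatrix'_comp,
      show Matrix.toLin' A = i ∘ₗ p from hf, LinearMap.comp_assoc, LinearMap.comp_assoc, hs,
      LinearMap.comp_id, hl, LinearMap.toMatrix'_id]

theorem exists_smul_eq_map {R : Type*} [CommRing R] [IsDomain R] {m n : ℕ}
    (X : Matrix (Fin m) (Fin n) (FractionRing R)) :
    ∃ (d : R) (Y : Matrix (Fin m) (Fin n) R), d ≠ 0 ∧
      d • X = Y.map (algebraMap R (FractionRing R)) := by
  obtain ⟨d, hd⟩ := IsLocalization.exist_integer_multiples_of_finite (nonZeroDivisors R)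
    (fun ij : Fin m × Fin n => X ij.1 ij.2)
  choose Y hY using hd
  exact ⟨d, fun i j => Y (i, j), nonZeroDivisors.ne_zero d.2, by
    ext i j
    exact (hY (i, j)).symm⟩

/-- Over a domain every matrix `N` is, up to nonzero scalars, equivalent to an identity matrix in
the sense that each of the two factors through the other. -/
theorem exists_smul_rank_factorization {R : Type*} [CommRing R] [IsDomain R] {a b : ℕ}
    (N : Matrix (Fin a) (Fin b) R) :
    ∃ (r : ℕ) (B : Matrix (Fin a) (Fin r) R) (C : Matrix (Fin r) (Fin b) R)
      (L : Matrix (Fin r) (Fin a) R) (S : Matrix (Fin b) (Fin r) R) (f g : R),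
      f ≠ 0 ∧ g ≠ 0 ∧ f • N = B * C ∧ L * N * S = g • 1 := by
  obtain ⟨r, B, C, L, S, h1, h2⟩ :=
    exists_rank_factorization (N.map (algebraMap R (FractionRing R)))
  obtain ⟨dB, B', hB0, hB⟩ := exists_smul_eq_map B
  obtain ⟨dC, C', hC0, hC⟩ := exists_smul_eq_map C
  obtain ⟨dL, L', hL0, hL⟩ := exists_smul_eq_map L
  obtain ⟨dS, S', hS0, hS⟩ := exists_smul_eq_map S
  have hinj := IsFractionRing.injective R (FractionRing R)
  have hmap : ∀ {m n : ℕ} (X Y : Matrix (Fin m) (Fin n) R),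
      X.map (algebraMap R (FractionRing R)) = Y.map (algebraMap R (FractionRing R)) → X = Y :=
    fun X Y h => Matrix.map_injective hinj h
  have hsmul : ∀ {m n : ℕ} (d : R) (X : Matrix (Fin m) (Fin n) R),
      (d • X).map (algebraMap R (FractionRing R)) = d • X.map (algebraMap R (FractionRing R)) :=
    fun d X => by
      ext i j
      simp [Algebra.smul_def]
  refine ⟨r, B', C', L', S', dB * dC, dL * dS, mul_ne_zero hB0 hC0, mul_ne_zero hL0 hS0,
    hmap _ _ ?_, hmap _ _ ?_⟩
  · rw [Matrix.map_mul, ← hB, ← hC, hsmul, h1, Matrix.smul_mul, Matrix.mul_smul, smul_smul]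
  · rw [Matrix.map_mul, Matrix.map_mul, ← hL, ← hS, hsmul, Matrix.smul_mul, Matrix.smul_mul,
      Matrix.mul_smul, smul_smul, h2, Matrix.map_one _ (map_zero _) (map_one _)]

end RankFactorization

/-! ### Reduction to matrices over `ℝ[st + ts]` -/

section Reduction

open Polynomial

variable (q : Gen → ℝ) (hq : ∀ i, 0 < q i)

theorem aeval_zed_commute (p : ℝ[X]) (y : MonoidAlgebra ℝ W) :
    aeval zed p * y = y * aeval zed p := by
  have h : aeval zed p ∈ Subalgebra.center ℝ (MonoidAlgebra ℝ W) := by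
    refine Algebra.adjoin_le (S := Subalgebra.center ℝ (MonoidAlgebra ℝ W)) (s := {zed}) ?_
      (aeval_mem_adjoin_singleton ℝ zed)
    rw [Set.singleton_subset_iff, SetLike.mem_coe, Subalgebra.mem_center_iff]
    exact fun y => (zed_commute y).symm
  exact (Subalgebra.mem_center_iff.mp h y).symm

theorem rightMul_aeval_zed (p : ℝ[X]) (x : L2) :
    rightMul q hq (aeval zed p) x = aeval (rightMul q hq zed).toLinearMap p x := by
  induction p using Polynomial.induction_on generalizing x with
  | C a =>
    rw [aeval_C, aeval_C, Algebra.algebraMap_eq_smul_one, Algebra.algebraMap_eq_smul_one,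
      rightMul_smul, rightMul_one]
    rfl
  | add p p' h h' => rw [map_add, map_add, rightMul_add, add_apply, h, h']; rfl
  | monomial n a h =>
    rw [pow_succ, ← mul_assoc, map_mul, aeval_X, ← zed_commute, rightMul_mul, h,
      map_mul _ _ X, aeval_X]
    rfl

/-- The central element `(st + ts)² - 4`, which annihilates the four one-dimensional
representations of `W`. -/
def disc : MonoidAlgebra ℝ W := aeval zed (X ^ 2 - C (4 : ℝ))

theorem disc_eq : disc = (zed - (2 * 1 : ℝ) • 1) * (zed - (2 * (-1) : ℝ) • 1) := by
  unfold disc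
  rw [map_sub, map_pow, aeval_X, aeval_C, Algebra.algebraMap_eq_smul_one]
  simp only [mul_sub, sub_mul, mul_smul_comm, smul_mul_assoc, mul_one, one_mul, pow_two]
  module

/-- The torsion of `L²_q W` over the central subring `ℝ[st + ts]` is annihilated by `disc`. -/
theorem rightMul_disc_eq_zero {f : ℝ[X]} (hf : f ≠ 0) {x : L2}
    (hx : rightMul q hq (aeval zed f) x = 0) : rightMul q hq disc x = 0 := by
  unfold disc
  rw [rightMul_aeval_zed] at hx ⊢
  refine aeval_apply_eq_zero_of_symmetric ?_ hf (fun c v hv => ?_) hx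
  · intro x y
    change ⟪rightMul q hq zed x, y⟫_ℝ = ⟪x, rightMul q hq zed y⟫_ℝ
    rw [rightMul_zed, rightMul_zed, inner_add_left, inner_add_right]
    simp only [inner_rightGen]
    rw [add_comm]
  · have h4 : (c ^ 2 - 4) • v = 0 := by
      by_cases hv0 : v = 0
      · rw [hv0, smul_zero]
      · rw [eigenvalue_zed q hq hv0 hv, sub_self, zero_smul]
    rw [map_sub, map_pow, aeval_X, aeval_C, LinearMap.sub_apply, pow_two, Module.End.mul_apply, hv,
      map_smul, hv, smul_smul, ← pow_two, Module.algebraMap_end_apply, ← sub_smul, h4]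

/-- Up to elements of `Λ_q`, dimensions of kernels do not change on multiplication by `disc`. -/
theorem heckeDim_disc_smul {m n : ℕ} (M : Matrix (Fin m) (Fin n) (MonoidAlgebra ℝ W)) :
    heckeDim q (kerRightMul q hq (disc • M)) - heckeDim q (kerRightMul q hq M) ∈ Lambda q := by
  have hcomm : ∀ (a : ℝ) y, (zed - a • 1) * y = y * (zed - a • 1) := fun a y => by
    rw [sub_mul, mul_sub, zed_commute, smul_mul_assoc, mul_smul_comm, one_mul, mul_one]
  have h1 := heckeDim_smul_sub_mem_Lambda q hq (hcomm _) (thin_zed_sub q hq (Or.inr rfl)) M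
  have h2 := heckeDim_smul_sub_mem_Lambda q hq (hcomm _) (thin_zed_sub q hq (Or.inl rfl))
    ((zed - (2 * (-1) : ℝ) • 1 : MonoidAlgebra ℝ W) • M)
  rw [smul_smul, ← disc_eq] at h2
  have h3 := add_mem h2 h1
  rwa [sub_add_sub_cancel] at h3

/-- The rank of `R_M` on the orthogonal complement of the torsion of `L²_q W`. -/
def genericRank {m n : ℕ} (M : Matrix (Fin m) (Fin n) (MonoidAlgebra ℝ W)) : ℝ :=
  rank q hq (disc • M)

theorem genericRank_mul_le_left {m n p : ℕ} (M : Matrix (Fin m) (Fin n) (MonoidAlgebra ℝ W))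
    (N : Matrix (Fin n) (Fin p) (MonoidAlgebra ℝ W)) :
    genericRank q hq (M * N) ≤ genericRank q hq M := by
  unfold genericRank
  rw [← Matrix.smul_mul]
  exact rank_mul_le_left q hq _ _

theorem genericRank_mul_le_right {m n p : ℕ} (M : Matrix (Fin m) (Fin n) (MonoidAlgebra ℝ W))
    (N : Matrix (Fin n) (Fin p) (MonoidAlgebra ℝ W)) :
    genericRank q hq (M * N) ≤ genericRank q hq N := by
  unfold genericRank
  have e : disc • (M * N) = M * disc • N := by
    ext1 i j
    simp only [Matrix.smul_apply, Matrix.mul_apply, smul_eq_mul, Finset.mul_sum]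
    refine Finset.sum_congr rfl fun k _ => ?_
    rw [← mul_assoc, ← mul_assoc, disc, aeval_zed_commute]
  rw [e]
  exact rank_mul_le_right q hq _ _

theorem genericRank_aeval_smul {f : ℝ[X]} (hf : f ≠ 0) {m n : ℕ}
    (M : Matrix (Fin m) (Fin n) (MonoidAlgebra ℝ W)) :
    genericRank q hq (aeval zed f • M) = genericRank q hq M := by
  unfold genericRank rank
  congr 1
  refine heckeDim_congr q (Submodule.ext fun x => ?_)
  have h : disc • aeval zed f • M = aeval zed (f * (X ^ 2 - C (4 : ℝ))) • M := by
    rw [smul_smul, disc, aeval_zed_commute, map_mul]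
  have hdisc : ∀ y, disc * y = y * disc := aeval_zed_commute _
  have h4 : f * (X ^ 2 - C (4 : ℝ)) ≠ 0 :=
    mul_ne_zero hf (X_pow_sub_C_ne_zero two_pos 4)
  rw [h, mem_kerRightMul_central_smul q hq (aeval_zed_commute _),
    mem_kerRightMul_central_smul q hq hdisc]
  refine forall_congr' fun j => ⟨fun h => rightMul_disc_eq_zero q hq h4 h, fun h => ?_⟩
  rw [mul_comm, map_mul, rightMul_mul, ← disc, h, map_zero]

/-- The idempotent `(1 + s) / 2`, resp. `(1 + t) / 2`, of `ℝW`. -/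
def idem (i : Gen) : MonoidAlgebra ℝ W := (1 / 2 : ℝ) • (1 + MonoidAlgebra.of ℝ W (gen i))

theorem idem_mul_gen (i : Gen) : idem i * MonoidAlgebra.of ℝ W (gen i) = idem i := by
  rw [idem, smul_mul_assoc, add_mul, one_mul, of_gen_mul_self, add_comm]

theorem gen_mul_idem (i : Gen) : MonoidAlgebra.of ℝ W (gen i) * idem i = idem i := by
  rw [idem, mul_smul_comm, mul_add, mul_one, of_gen_mul_self, add_comm]

theorem idem_mul_self (i : Gen) : idem i * idem i = idem i := by
  nth_rewrite 1 [idem]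
  rw [smul_mul_assoc, add_mul, one_mul, gen_mul_idem]
  module

theorem rot_add_rot (i : ℤ) : MonoidAlgebra.of ℝ W (rot (i + 1)) +
    MonoidAlgebra.of ℝ W (rot (i - 1)) = zed * MonoidAlgebra.of ℝ W (rot i) := by
  rw [zed, add_mul, ← map_mul, ← map_mul, ← map_mul, ← map_mul]
  have h1 : gen Gen.s * gen Gen.t * rot i = rot (i + 1) := congrArg rot (add_comm 1 i)
  have h2 : gen Gen.t * gen Gen.s * rot i = rot (i - 1) := congrArg rot (by
    change (0 - 1 : ℤ) + i = i - 1
    ring)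
  rw [h1, h2]

/-- The corner of `ℝW` at the idempotent `(1 + s) / 2` is generated by the image of the centre:
the elements `e (st)^n e` are the Chebyshev polynomials in `(st + ts) / 2`. -/
theorem idem_mul_mul_idem (y : MonoidAlgebra ℝ W) :
    ∃ p : ℝ[X], idem Gen.s * y * idem Gen.s = aeval zed p * idem Gen.s := by
  set e := idem Gen.s with he
  set S := MonoidAlgebra.of ℝ W (gen Gen.s) with hS
  have heS : e * S = e := idem_mul_gen Gen.s
  have hSe : S * e = e := gen_mul_idem Gen.s
  have hee : e * e = e := idem_mul_self Gen.s
  have hneg : ∀ i, e * MonoidAlgebra.of ℝ W (rot (-i)) * e = e * MonoidAlgebra.of ℝ W (rot i) * e := by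
    intro i
    have h : gen Gen.s * rot i * gen Gen.s = rot (-i) := congrArg rot (by
      change (0 : ℤ) - (0 + i) = -i
      ring)
    rw [← h, map_mul, map_mul, ← hS, ← mul_assoc, ← mul_assoc, heS, mul_assoc _ S, hSe]
  have hrec : ∀ i, e * MonoidAlgebra.of ℝ W (rot (i + 1)) * e =
      zed * (e * MonoidAlgebra.of ℝ W (rot i) * e) -
        e * MonoidAlgebra.of ℝ W (rot (i - 1)) * e := by
    intro i
    rw [eq_sub_iff_add_eq, ← add_mul, ← mul_add, rot_add_rot, ← mul_assoc e, ← zed_commute e,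
      mul_assoc zed, mul_assoc zed]
  have hnat : ∀ n : ℕ, (∃ p : ℝ[X], e * MonoidAlgebra.of ℝ W (rot n) * e = aeval zed p * e) ∧
      ∃ p : ℝ[X], e * MonoidAlgebra.of ℝ W (rot (n + 1)) * e = aeval zed p * e := by
    intro n
    induction n with
    | zero =>
      have h0 : e * MonoidAlgebra.of ℝ W (rot 0) * e = e := by
        rw [rot_zero, map_one, mul_one, hee]
      refine ⟨⟨1, by rw [Nat.cast_zero, h0, map_one, one_mul]⟩, C (1 / 2) * X, ?_⟩
      have h := hrec 0
      rw [zero_sub, hneg, zero_add, h0, eq_sub_iff_add_eq, ← two_smul ℝ] at h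
      rw [Nat.cast_zero, zero_add, map_mul, aeval_X, aeval_C, Algebra.algebraMap_eq_smul_one,
        smul_mul_assoc, one_mul, smul_mul_assoc, ← h, smul_smul]
      norm_num
    | succ n ih =>
      obtain ⟨⟨p, hp⟩, ⟨p', hp'⟩⟩ := ih
      refine ⟨⟨p', by rw [Nat.cast_succ, hp']⟩, X * p' - p, ?_⟩
      rw [Nat.cast_succ, hrec, hp', add_sub_cancel_right, hp, map_sub, map_mul, aeval_X, sub_mul,
        mul_assoc]
  have hrot : ∀ i, ∃ p : ℝ[X], e * MonoidAlgebra.of ℝ W (rot i) * e = aeval zed p * e := by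
    intro i
    obtain ⟨n, rfl | rfl⟩ := i.eq_nat_or_neg
    · exact (hnat n).1
    · rw [hneg]
      exact (hnat n).1
  refine MonoidAlgebra.induction_on
    (motive := fun y => ∃ p : ℝ[X], e * y * e = aeval zed p * e) y
    (fun w => ?_) ?_ ?_
  · cases w with
    | r i => exact hrot i
    | sr i =>
      have h : (DihedralGroup.sr i : W) = gen Gen.s * rot i :=
        congrArg refl (zero_add (show ℤ from i)).symm
      rw [h, map_mul, ← mul_assoc, ← hS, heS]
      exact hrot i
  · rintro a b ⟨p, hp⟩ ⟨p', hp'⟩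
    exact ⟨p + p', by rw [mul_add, add_mul, hp, hp', map_add, add_mul]⟩
  · rintro c a ⟨p, hp⟩
    exact ⟨c • p, by rw [mul_smul_comm, smul_mul_assoc, hp, map_smul, smul_mul_assoc]⟩

/-- The value `1 - z²/4` at `z = st + ts` of the product of the two off-diagonal matrix units
`e t (1 - e)` and `(1 - e) t e`, where `e = (1 + s) / 2`. -/
def unitProd : ℝ[X] := 1 - C (1 / 4) * X ^ 2

theorem unitProd_ne_zero : unitProd ≠ 0 := by
  intro h
  have := congrArg (Polynomial.eval 0) h
  simp [unitProd] at this

theorem aeval_unitProd : aeval zed unitProd = 1 - (1 / 4 : ℝ) • (zed * zed) := by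
  rw [unitProd, map_sub, map_one, map_mul, map_pow, aeval_X, aeval_C,
    Algebra.algebraMap_eq_smul_one, smul_mul_assoc, one_mul, pow_two]

theorem offDiagonal_mul :
    (1 - idem Gen.s) * MonoidAlgebra.of ℝ W (gen Gen.t) * idem Gen.s *
        (idem Gen.s * MonoidAlgebra.of ℝ W (gen Gen.t) * (1 - idem Gen.s)) =
      aeval zed unitProd * (1 - idem Gen.s) := by
  obtain ⟨f, hf⟩ : ∃ f, f = 1 - idem Gen.s := ⟨_, rfl⟩
  have he : idem Gen.s = 1 - f := by rw [hf, sub_sub_cancel]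
  have hff : f * f = f := hf ▸ (IsIdempotentElem.one_sub (idem_mul_self Gen.s)).eq
  have hee := idem_mul_self Gen.s
  have hfs : f * MonoidAlgebra.of ℝ W (gen Gen.s) = -f := by
    rw [hf, sub_mul, one_mul, idem_mul_gen, idem]
    module
  have hsf : MonoidAlgebra.of ℝ W (gen Gen.s) * f = -f := by
    rw [hf, mul_sub, mul_one, gen_mul_idem, idem]
    module
  have htt := of_gen_mul_self Gen.t
  rw [← hf]
  have hzf : f * zed * f = zed * f := by rw [← zed_commute, mul_assoc, hff]
  have hftf : f * MonoidAlgebra.of ℝ W (gen Gen.t) * f = (-1 / 2 : ℝ) • (zed * f) := by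
    rw [← hzf, zed, mul_add, add_mul, ← mul_assoc, hfs, ← mul_assoc f, mul_assoc (f * _) _ f, hsf,
      neg_mul, neg_mul, mul_neg]
    module
  set t := MonoidAlgebra.of ℝ W (gen Gen.t)
  calc f * t * idem Gen.s * (idem Gen.s * t * f) = f * t * (idem Gen.s * idem Gen.s) * (t * f) := by
        simp only [mul_assoc]
    _ = f * (t * t) * f - f * t * (f * f) * (t * f) := by
        rw [hee, hff, he]
        simp only [mul_sub, sub_mul, mul_one, mul_assoc]
    _ = f * (t * t) * f - (f * t * f) * (f * t * f) := by simp only [mul_assoc]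
    _ = f - (1 / 4 : ℝ) • (zed * (f * zed * f)) := by
        rw [htt, mul_one, hff, hftf, smul_mul_smul_comm]
        simp only [mul_assoc]
        norm_num
    _ = aeval zed unitProd * f := by
        rw [hzf, aeval_unitProd, sub_mul, one_mul, smul_mul_assoc, mul_assoc]

/-- The generic rank is the rank function of the field of fractions of `ℝ[st + ts]` on the corner
at `e = (1 + s) / 2`, scaled by the generic rank of `e`. -/
theorem exists_genericRank_corner {a b : ℕ} (F : Matrix (Fin a) (Fin b) (MonoidAlgebra ℝ W))
    (hF : ∀ i j, idem Gen.s * F i j * idem Gen.s = F i j) :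
    ∃ r : ℕ, genericRank q hq F =
      r * genericRank q hq (Matrix.scalar (Fin 1) (idem Gen.s)) := by
  have hp : ∀ i j, ∃ p : ℝ[X], F i j = aeval zed p * idem Gen.s := fun i j => by
    rw [← hF]
    exact idem_mul_mul_idem _
  obtain ⟨N, hN⟩ : ∃ N : Matrix (Fin a) (Fin b) ℝ[X],
      ∀ i j, F i j = aeval zed (N i j) * idem Gen.s := by
    choose N hN using hp
    exact ⟨N, hN⟩
  let ev : ∀ {m n : ℕ}, Matrix (Fin m) (Fin n) ℝ[X] →
      Matrix (Fin m) (Fin n) (MonoidAlgebra ℝ W) := fun P => P.map (aeval zed)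
  have hev_mul : ∀ {m n k : ℕ} (P : Matrix (Fin m) (Fin n) ℝ[X]) (P' : Matrix (Fin n) (Fin k) ℝ[X]),
      ev (P * P') = ev P * ev P' := fun P P' => Matrix.map_mul (f := (aeval zed).toRingHom)
  have hev_smul : ∀ {m n : ℕ} (f : ℝ[X]) (P : Matrix (Fin m) (Fin n) ℝ[X]),
      ev (f • P) = aeval zed f • ev P := fun f P => by
    ext1 i j
    exact map_mul (aeval zed) f (P i j)
  have hcomm : ∀ {m n : ℕ} (P : Matrix (Fin m) (Fin n) ℝ[X]),
      ev P * Matrix.scalar (Fin n) (idem Gen.s) = Matrix.scalar (Fin m) (idem Gen.s) * ev P :=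
    fun P => by
      ext1 i j
      rw [Matrix.scalar_apply, Matrix.scalar_apply, Matrix.mul_diagonal, Matrix.diagonal_mul]
      exact aeval_zed_commute _ _
  have hFN : F = ev N * Matrix.scalar (Fin b) (idem Gen.s) := by
    ext1 i j
    rw [Matrix.scalar_apply, Matrix.mul_diagonal]
    exact hN i j
  obtain ⟨r, B, D, L, S, f, g, hf, hg, h1, h2⟩ := exists_smul_rank_factorization N
  have hscalar : genericRank q hq (Matrix.scalar (Fin r) (idem Gen.s)) =
      r * genericRank q hq (Matrix.scalar (Fin 1) (idem Gen.s)) := by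
    have e : ∀ n : ℕ, disc • Matrix.scalar (Fin n) (idem Gen.s) =
        Matrix.scalar (Fin n) (disc * idem Gen.s) := fun n => by
      rw [Matrix.scalar_apply, Matrix.scalar_apply, ← Matrix.diagonal_smul]
      rfl
    unfold genericRank
    rw [e, e, rank_scalar]
  refine ⟨r, ?_⟩
  rw [← hscalar]
  apply le_antisymm
  · rw [← genericRank_aeval_smul q hq hf, hFN, ← Matrix.smul_mul, ← hev_smul, h1, hev_mul,
      Matrix.mul_assoc, hcomm]
    exact (genericRank_mul_le_right q hq _ _).trans (genericRank_mul_le_left q hq _ _)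
  · have e : aeval zed g • Matrix.scalar (Fin r) (idem Gen.s) = ev L * F * ev S := by
      have h3 : ev (g • (1 : Matrix (Fin r) (Fin r) ℝ[X])) =
          aeval zed g • (1 : Matrix (Fin r) (Fin r) (MonoidAlgebra ℝ W)) := by
        rw [hev_smul]
        congr 1
        exact Matrix.map_one _ (map_zero _) (map_one _)
      rw [hFN, Matrix.mul_assoc, Matrix.mul_assoc, ← hcomm S, ← Matrix.mul_assoc,
        ← Matrix.mul_assoc, ← hev_mul, ← hev_mul, h2, h3, Matrix.smul_mul, Matrix.one_mul]
    rw [← genericRank_aeval_smul q hq hg, e]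
    exact (genericRank_mul_le_left q hq _ _).trans (genericRank_mul_le_right q hq _ _)

/-- After inverting `1 - z²/4`, the idempotent `e = (1 + s) / 2` becomes a full idempotent of
`ℝW`, so every matrix can be replaced by one with entries in the corner at `e`. -/
theorem exists_genericRank {m n : ℕ} (M : Matrix (Fin m) (Fin n) (MonoidAlgebra ℝ W)) :
    ∃ r : ℕ, genericRank q hq M =
      r * genericRank q hq (Matrix.scalar (Fin 1) (idem Gen.s)) := by
  set e := idem Gen.s with he
  set t := MonoidAlgebra.of ℝ W (gen Gen.t) with ht
  set k := aeval zed unitProd with hk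
  have hee : e * e = e := idem_mul_self Gen.s
  have hk_comm : ∀ y, k * y = y * k := aeval_zed_commute _
  have hoff : (1 - e) * t * e * (e * t * (1 - e)) = k * (1 - e) := offDiagonal_mul
  let σ : ∀ p : ℕ, Fin (p + p) ≃ Fin p ⊕ Fin p := fun p => finSumFinEquiv.symm
  let col : ∀ (p : ℕ) (a b : MonoidAlgebra ℝ W), Matrix (Fin (p + p)) (Fin p) (MonoidAlgebra ℝ W) :=
    fun p a b => (Matrix.fromRows (Matrix.scalar (Fin p) a) (Matrix.scalar (Fin p) b)).submatrix
      (σ p) id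
  let row : ∀ (p : ℕ) (a b : MonoidAlgebra ℝ W), Matrix (Fin p) (Fin (p + p)) (MonoidAlgebra ℝ W) :=
    fun p a b => (Matrix.fromCols (Matrix.scalar (Fin p) a) (Matrix.scalar (Fin p) b)).submatrix
      id (σ p)
  have hrc : ∀ (p : ℕ) (a b a' b' : MonoidAlgebra ℝ W), row p a b * col p a' b' =
      Matrix.scalar (Fin p) (a * a' + b * b') := fun p a b a' b' => by
    rw [Matrix.submatrix_mul_equiv, Matrix.fromCols_mul_fromRows, Matrix.submatrix_id_id,
      map_add, map_mul, map_mul]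
  have hcol : ∀ (p : ℕ) (a b c : MonoidAlgebra ℝ W), Matrix.scalar (Fin (p + p)) c * col p a b =
      col p (c * a) (c * b) := fun p a b c => by
    ext1 i j
    rw [Matrix.scalar_apply, Matrix.diagonal_mul]
    change c * Matrix.fromRows _ _ (σ p i) j = Matrix.fromRows _ _ (σ p i) j
    rcases σ p i with i | i <;> simp [Matrix.scalar_apply, Matrix.diagonal_apply]
  have hrow : ∀ (p : ℕ) (a b c : MonoidAlgebra ℝ W), row p a b * Matrix.scalar (Fin (p + p)) c =
      row p (a * c) (b * c) := fun p a b c => by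
    ext1 i j
    rw [Matrix.scalar_apply, Matrix.mul_diagonal]
    change Matrix.fromCols _ _ i (σ p j) * c = Matrix.fromCols _ _ i (σ p j)
    rcases σ p j with j | j <;> simp [Matrix.scalar_apply, Matrix.diagonal_apply]
  let F := col m e (e * t * (1 - e)) * M * row n e ((1 - e) * t * e)
  have hF : Matrix.scalar (Fin (m + m)) e * F * Matrix.scalar (Fin (n + n)) e = F := by
    simp only [F]
    rw [Matrix.mul_assoc, Matrix.mul_assoc _ _ (Matrix.scalar _ _), hrow, ← Matrix.mul_assoc,
      ← Matrix.mul_assoc, hcol]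
    simp only [← mul_assoc, hee]
    simp only [mul_assoc, hee]
  obtain ⟨r, hr⟩ := exists_genericRank_corner q hq F fun i j => by
    have h := congrFun (congrFun hF i) j
    rwa [Matrix.scalar_apply, Matrix.scalar_apply, Matrix.mul_diagonal, Matrix.diagonal_mul] at h
  refine ⟨r, ?_⟩
  rw [← hr]
  apply le_antisymm
  · have hsc : ∀ (p p' : ℕ) (X : Matrix (Fin p) (Fin p') (MonoidAlgebra ℝ W)),
        Matrix.scalar (Fin p) k * X = k • X := fun p p' X => by
      ext1 i j
      rw [Matrix.scalar_apply, Matrix.diagonal_mul]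
      rfl
    have hl : row m (k * e) ((1 - e) * t * e) * col m e (e * t * (1 - e)) =
        Matrix.scalar (Fin m) k := by
      rw [hrc, hoff, mul_assoc, hee, ← mul_add, add_sub_cancel, mul_one]
    have hr' : row n e ((1 - e) * t * e) * col n (k * e) (e * t * (1 - e)) =
        Matrix.scalar (Fin n) k := by
      rw [hrc, hoff, ← mul_assoc, ← hk_comm, mul_assoc, hee, ← mul_add, add_sub_cancel, mul_one]
    have hM : aeval zed (unitProd * unitProd) • M =
        row m (k * e) ((1 - e) * t * e) * F * col n (k * e) (e * t * (1 - e)) := by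
      simp only [F]
      rw [Matrix.mul_assoc, Matrix.mul_assoc, Matrix.mul_assoc, hr', ← Matrix.mul_assoc, hl, hsc,
        map_mul, ← hk, ← smul_smul]
      congr 1
      ext1 i j
      rw [Matrix.scalar_apply, Matrix.mul_diagonal]
      exact hk_comm _
    rw [← genericRank_aeval_smul q hq (mul_ne_zero unitProd_ne_zero unitProd_ne_zero), hM]
    exact (genericRank_mul_le_left q hq _ _).trans (genericRank_mul_le_right q hq _ _)
  · exact (genericRank_mul_le_left q hq _ _).trans (genericRank_mul_le_right q hq _ _)

theorem invol_one_sub (y : MonoidAlgebra ℝ W) : invol (1 - y) = 1 - invol y := by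
  rw [sub_eq_add_neg, ← neg_one_smul ℝ y, invol_add, invol_smul, MonoidAlgebra.one_def,
    invol_single, inv_one, neg_one_smul, ← sub_eq_add_neg]

/-- For a self-adjoint idempotent `y`, the kernel of right multiplication by `1 - y` is the image
of `y`, and has dimension `τ(y)`. -/
theorem heckeDim_ker_one_sub {y : MonoidAlgebra ℝ W} (hy : y * y = y) (hy' : invol y = y) :
    heckeDim q (kerRightMul q hq (Matrix.scalar (Fin 1) (1 - y))) = tau q hq y := by
  have hadj : adj (Matrix.scalar (Fin 1) (1 - y)) = Matrix.scalar (Fin 1) (1 - y) := by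
    ext1 i j
    have hij : i = j := Subsingleton.elim i j
    subst hij
    rw [adj, Matrix.map_apply, Matrix.transpose_apply, Matrix.scalar_apply,
      Matrix.diagonal_apply_eq, invol_one_sub, hy']
  have htr : (Matrix.scalar (Fin 1) y).trace = y := by
    simp [Matrix.trace]
  have hsub : ∀ x, rightMulMatrix q hq (Matrix.scalar (Fin 1) (1 - y)) x =
      x - rightMulMatrix q hq (Matrix.scalar (Fin 1) y) x := fun x => by
    rw [map_sub, map_one, rightMulMatrix_sub, rightMulMatrix_one]
  rw [show tau q hq y = _ from congrArg _ htr.symm, ← sum_inner_stdBasis]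
  refine Finset.sum_congr rfl fun i _ => ?_
  congr 1
  refine Submodule.eq_starProjection_of_mem_of_inner_eq_zero ?_ fun w hw => ?_
  · rw [mem_kerRightMul, hsub, ← rightMulMatrix_mul, ← map_mul, hy, sub_self]
  · rw [← hsub, inner_rightMulMatrix, hadj, (mem_kerRightMul q hq).mp hw, inner_zero_right]

theorem invol_idem (i : Gen) : invol (idem i) = idem i := by
  rw [idem, invol_smul, invol_add, MonoidAlgebra.of_apply, invol_single, gen_inv,
    MonoidAlgebra.one_def, invol_single, inv_one]

theorem tau_idem (i : Gen) : tau q hq (idem i) = 1 / (1 + q i) := by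
  have h := hq i
  rw [idem, map_smul, map_add, tau_one, tau_gen, smul_eq_mul]
  field_simp
  ring

theorem heckeDim_mem_Lambda {m n : ℕ} (M : Matrix (Fin m) (Fin n) (MonoidAlgebra ℝ W)) :
    heckeDim q (kerRightMul q hq M) ∈ Lambda q := by
  have hnat : ∀ n : ℕ, (n : ℝ) ∈ Lambda q := fun n => by
    rw [← nsmul_one]
    exact nsmul_mem (one_mem_Lambda q) n
  have h1 := heckeDim_disc_smul q hq M
  have h2 := heckeDim_disc_smul q hq (Matrix.scalar (Fin 1) (idem Gen.s))
  have h3 : heckeDim q (kerRightMul q hq (Matrix.scalar (Fin 1) (idem Gen.s))) =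
      1 - 1 / (1 + q Gen.s) := by
    have h := heckeDim_ker_one_sub q hq (y := 1 - idem Gen.s)
      (IsIdempotentElem.one_sub (idem_mul_self Gen.s)) (by rw [invol_one_sub, invol_idem])
    rwa [sub_sub_cancel, map_sub, tau_one, tau_idem] at h
  obtain ⟨r, hr⟩ := exists_genericRank q hq M
  have h4 : genericRank q hq (Matrix.scalar (Fin 1) (idem Gen.s)) ∈ Lambda q := by
    have h5 := add_mem h2 (h3 ▸ sub_mem (one_mem_Lambda q) (one_div_add_mem_Lambda q Gen.s))
    rw [sub_add_cancel] at h5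
    exact sub_mem (hnat 1) h5
  have h6 : genericRank q hq M ∈ Lambda q := by
    rw [hr, ← nsmul_eq_mul]
    exact nsmul_mem h4 r
  have h7 := sub_mem (sub_mem (hnat m) h6) h1
  have e : heckeDim q (kerRightMul q hq M) = (m : ℝ) - genericRank q hq M -
      (heckeDim q (kerRightMul q hq (disc • M)) - heckeDim q (kerRightMul q hq M)) := by
    unfold genericRank rank
    ring
  rwa [e]

theorem heckeDim_ker_zero_cols (M : Matrix (Fin 1) (Fin 0) (MonoidAlgebra ℝ W)) :
    heckeDim q (kerRightMul q hq M) = 1 := by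
  have h : ∀ x, x ∈ kerRightMul q hq M := fun x => by
    rw [mem_kerRightMul]
    ext1 j
    exact j.elim0
  unfold heckeDim
  rw [Fin.sum_univ_one, Submodule.starProjection_eq_self_iff.mpr (h _), inner_stdBasis,
    stdBasis_apply, if_pos rfl, inner_T_one_T_one]

end Reduction

end HeckeDihedral

end

theorem theorem4 (q : HeckeDihedral.Gen → ℝ) (hq : ∀ i, 0 < q i) :
    (∀ (m n : ℕ) (M : Matrix (Fin m) (Fin n) (MonoidAlgebra ℝ HeckeDihedral.W)),
      HeckeDihedral.heckeDim q (HeckeDihedral.kerRightMul q hq M) ∈ HeckeDihedral.Lambda q) ∧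
    (∀ Γ : AddSubgroup ℝ,
      (∀ (m n : ℕ) (M : Matrix (Fin m) (Fin n) (MonoidAlgebra ℝ HeckeDihedral.W)),
        HeckeDihedral.heckeDim q (HeckeDihedral.kerRightMul q hq M) ∈ Γ) →
      HeckeDihedral.Lambda q ≤ Γ) := by
  refine ⟨fun m n M => HeckeDihedral.heckeDim_mem_Lambda q hq M, fun Γ hΓ => ?_⟩
  have h1 : (1 : ℝ) ∈ Γ := HeckeDihedral.heckeDim_ker_zero_cols q hq 0 ▸ hΓ 1 0 0
  have h2 : ∀ i, 1 / (1 + q i) ∈ Γ := fun i => by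
    rw [← HeckeDihedral.tau_idem q hq, ← HeckeDihedral.heckeDim_ker_one_sub q hq
      (HeckeDihedral.idem_mul_self i) (HeckeDihedral.invol_idem i)]
    exact hΓ 1 1 _
  refine (AddSubgroup.closure_le Γ).mpr ?_
  rintro x (rfl | rfl | rfl)
  · exact h1
  · exact h2 _
  · exact h2 _
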